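/- **Notation.** For $\varphi:\mathbb R^n\to(-\infty,\infty]$ with $\operatorname{dom}\varphi=\{x:\varphi(x)<\infty\}$, the regular subdifferential at $x\in\operatorname{dom}\varphi$ is $\widehat\partial\varphi(x)=\{v:\liminf_{u\to x,\,u\ne x}\frac{\varphi(u)-\varphi(x)-\langle v,u-x\rangle}{\|u-x\|}\ge 0\}$, and the limiting subdifferential $\partial\varphi(x)$ is the set of all limits $v=\lim v_k$ with $v_k\in\widehat\partial\varphi(x_k)$, $x_k\to x$, $\varphi(x_k)\to\varphi(x)$; both are empty for $x\notin\operatorname{dom}\varphi$. For a set $\Omega$ with indicator function $\delta_\Omega$ ($0$ on $\Omega$, $\infty$ elsewhere) put $\widehat N_\Omega=\widehat\partial\delta_\Omega$ and $N_\Omega=\partial\delta_\Omega$. For a set-valued mapping $F:\mathbb R^n\rightrightarrows\mathbb R^n$ with graph $\operatorname{gph}F=\{(x,y):y\in F(x)\}$ and $(x,y)\in\operatorname{gph}F$, the regular and limiting coderivatives are $\widehat D^*F(x,y)(w)=\{z:(z,-w)\in\widehat N_{\operatorname{gph}F}(x,y)\}$ and $D^*F(x,y)(w)=\{z:(z,-w)\in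 N_{\operatorname{gph}F}(x,y)\}$. For $(x,v)\in\operatorname{gph}\partial\varphi$ put $\partial^2\varphi(x,v)=D^*(\partial\varphi)(x,v)$ and $\breve\partial^2\varphi(x,v)=\widehat D^*(\partial\varphi)(x,v)$. Let $\bar x\in\operatorname{dom}\varphi$ and $\bar v\in\partial\varphi(\bar x)$. * $\varphi$ is *prox-regular at $\bar x$ for $\bar v$* if it is finite at $\bar x$, lower semicontinuous (l.s.c.) around $\bar x$, and there are $\varepsilon>0$ and $r\ge0$ such that $$\varphi(x)\ge\varphi(u)+\langle v,x-u\rangle-\tfrac r2\|x-u\|^2\qquad(\mathrm{PR})$$ whenever $\|x-\bar x\|<\varepsilon$, $\|u-\bar x\|<\varepsilon$, $\varphi(u)<\varphi(\bar x)+\varepsilon$, $v\in\partial\varphi(u)$ and $\|v-\bar v\|<\varepsilon$. We say that *(PR) holds for $\varepsilon$* if this is so for this $\varepsilon$ with some $r\ge 0$. * $\varphi$ is *subdifferentially continuous at $\bar x$ for $\bar v$* if $\varphi(x_k)\to\varphi(\bar x)$ whenever $(x_k,v_k)\to(\bar x,\bar v)$ with $v_k\in\partial\varphi(x_k)$ for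 all $k$. * The *$\varphi$-attentive $\varepsilon$-localization* of $\partial\varphi$ around $(\bar x,\bar v)$ is the mapping $T_\varepsilon$ with $T_\varepsilon(x)=\{v\in\partial\varphi(x):\|v-\bar v\|<\varepsilon\}$ if $\|x-\bar x\|<\varepsilon$ and $|\varphi(x)-\varphi(\bar x)|<\varepsilon$, and $T_\varepsilon(x)=\emptyset$ otherwise. * $\varphi$ is *variationally convex at $\bar x$ for $\bar v$* if there are convex neighborhoods $U$ of $\bar x$ and $V$ of $\bar v$, an l.s.c. convex function $\psi:\mathbb R^n\to(-\infty,\infty]$ with $\psi\le\varphi$ on $U$, and $\varepsilon>0$ such that, with $U_\varepsilon=\{x\in U:\varphi(x)<\varphi(\bar x)+\varepsilon\}$, one has $(U_\varepsilon\times V)\cap\operatorname{gph}\partial\varphi=(U\times V)\cap\operatorname{gph}\partial\psi$ and $\varphi(x)=\psi(x)$ at every common element $(x,v)$. **Theorem.** Let $\varphi:\mathbb R^n\to(-\infty,\infty]$ be l.s.c., $\bar x\in\operatorname{dom}\varphi$ and $\bar v\in\partial\varphi(\bar x)$. Then the following are equivalent: (i) $\varphi$ is variationally convex at $\bar x$ for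 $\bar v$. (ii) $\varphi$ is prox-regular at $\bar x$ for $\bar v$, and there are an $\varepsilon>0$ for which (PR) holds and a neighborhood $W$ of $(\bar x,\bar v)$ such that $\langle z,w\rangle\ge0$ whenever $z\in D^*T_\varepsilon(u,v)(w)$, $(u,v)\in\operatorname{gph}T_\varepsilon\cap W$ and $w\in\mathbb R^n$. (iii) $\varphi$ is prox-regular at $\bar x$ for $\bar v$, and there are an $\varepsilon>0$ for which (PR) holds and a neighborhood $W$ of $(\bar x,\bar v)$ such that $\langle z,w\rangle\ge0$ whenever $z\in\widehat D^*T_\varepsilon(u,v)(w)$, $(u,v)\in\operatorname{gph}T_\varepsilon\cap W$ and $w\in\mathbb R^n$. If in addition $\varphi$ is subdifferentially continuous at $\bar x$ for $\bar v$, then (i) is also equivalent to each of the following, where now $\varepsilon$ is not restricted by (PR): (ii′) $\varphi$ is prox-regular at $\bar x$ for $\bar v$, and there are $\varepsilon>0$ and a neighborhood $W$ of $(\bar x,\bar v)$ such that $\langle z,w\rangle\ge0$ whenever $z\in\partial^2\varphi(u,v)(w)$, $(u,v)\in\operatorname{gph}T_\varepsilon\cap W$ and $w\in\mathbb R^n$.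 (iii′) $\varphi$ is prox-regular at $\bar x$ for $\bar v$, and there are $\varepsilon>0$ and a neighborhood $W$ of $(\bar x,\bar v)$ such that $\langle z,w\rangle\ge0$ whenever $z\in\breve\partial^2\varphi(u,v)(w)$, $(u,v)\in\operatorname{gph}T_\varepsilon\cap W$ and $w\in\mathbb R^n$. -/

import Mathlib

open Filter Topology

section SubdifferentialTheory

variable {E G : Type*} [NormedAddCommGroup E] [InnerProductSpace ℝ E]
  [NormedAddCommGroup G] [InnerProductSpace ℝ G]

/-- The graph of a set-valued mapping. -/
def svGraph (F : E → Set G) : Set (E × G) := {p | p.2 ∈ F p.1}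

/-- The (Fréchet) regular subdifferential of an extended-real-valued function; it is empty
outside the domain. The lower limit is over `u → x` with `u ≠ x`. -/
noncomputable def regularSubdifferential (φ : E → EReal) (x : E) : Set E :=
  {v | φ x ≠ ⊤ ∧
    0 ≤ liminf (fun u : E => (φ u - φ x - ((inner ℝ v (u - x) : ℝ) : EReal)) / ((‖u - x‖ : ℝ) : EReal))
      (𝓝[≠] x)}

/-- The (Mordukhovich) limiting subdifferential: the outer limit of the regular subdifferential
along `x' → x` with `φ x' → φ x`; it is empty outside the domain. -/
noncomputable def limitingSubdifferential (φ : E → EReal) (x : E) : Set E :=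
  {v | φ x ≠ ⊤ ∧ ∃ (xs vs : ℕ → E),
    Tendsto xs atTop (𝓝 x) ∧ Tendsto (fun k => φ (xs k)) atTop (𝓝 (φ x)) ∧
    Tendsto vs atTop (𝓝 v) ∧ ∀ k, vs k ∈ regularSubdifferential φ (xs k)}

open Classical in
/-- The indicator function of a set in the sense of variational analysis: `0` on the set,
`∞` outside. -/
noncomputable def indicatorEReal (Ω : Set E) (x : E) : EReal := if x ∈ Ω then 0 else ⊤

/-- The regular normal cone. -/
noncomputable def regularNormalCone (Ω : Set E) (x : E) : Set E :=
  regularSubdifferential (indicatorEReal Ω) x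

/-- The limiting normal cone. -/
noncomputable def limitingNormalCone (Ω : Set E) (x : E) : Set E :=
  limitingSubdifferential (indicatorEReal Ω) x

/-- The graph of a set-valued mapping, placed in the Euclidean (`ℓ²`) product. -/
def svGraphL2 (F : E → Set G) : Set (WithLp 2 (E × G)) := {p | p.snd ∈ F p.fst}

/-- The regular coderivative of `F` at the graph point `(x, y)`. -/
noncomputable def regularCoderivative (F : E → Set G) (x : E) (y : G) (u : G) : Set E :=
  {v | WithLp.toLp 2 (v, -u) ∈ regularNormalCone (svGraphL2 F) (WithLp.toLp 2 (x, y))}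

/-- The limiting coderivative of `F` at the graph point `(x, y)`. -/
noncomputable def limitingCoderivative (F : E → Set G) (x : E) (y : G) (u : G) : Set E :=
  {v | WithLp.toLp 2 (v, -u) ∈ limitingNormalCone (svGraphL2 F) (WithLp.toLp 2 (x, y))}

/-- The limiting second-order subdifferential `∂²φ(x, v)(u)`. -/
noncomputable def limitingSecondSubdifferential (φ : E → EReal) (x v u : E) : Set E :=
  limitingCoderivative (limitingSubdifferential φ) x v u

/-- The combined second-order subdifferential: the regular coderivative of the limiting
subdifferential. -/
noncomputable def combinedSecondSubdifferential (φ : E → EReal) (x v u : E) : Set E :=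
  regularCoderivative (limitingSubdifferential φ) x v u

/-- The inequality in the definition of prox-regularity, with given constants `ε` and `r`. -/
def ProxRegularInequality (φ : E → EReal) (xbar vbar : E) (ε r : ℝ) : Prop :=
  ∀ x u v : E, ‖x - xbar‖ < ε → ‖u - xbar‖ < ε → ‖v - vbar‖ < ε →
    φ u < φ xbar + (ε : EReal) → v ∈ limitingSubdifferential φ u →
    φ u + ((inner ℝ v (x - u) - r / 2 * ‖x - u‖ ^ 2 : ℝ) : EReal) ≤ φ x

/-- Prox-regularity of `φ` at `xbar` for `vbar`. -/
def IsProxRegularAt (φ : E → EReal) (xbar vbar : E) : Prop :=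
  vbar ∈ limitingSubdifferential φ xbar ∧ φ xbar ≠ ⊤ ∧ φ xbar ≠ ⊥ ∧
  (∀ᶠ x in 𝓝 xbar, LowerSemicontinuousAt φ x) ∧
  ∃ ε : ℝ, 0 < ε ∧ ∃ r : ℝ, 0 ≤ r ∧ ProxRegularInequality φ xbar vbar ε r

/-- Subdifferential continuity of `φ` at `xbar` for `vbar`. -/
def IsSubdifferentiallyContinuousAt (φ : E → EReal) (xbar vbar : E) : Prop :=
  vbar ∈ limitingSubdifferential φ xbar ∧
  ∀ xs vs : ℕ → E, Tendsto xs atTop (𝓝 xbar) → Tendsto vs atTop (𝓝 vbar) →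
    (∀ k, vs k ∈ limitingSubdifferential φ (xs k)) →
    Tendsto (fun k => φ (xs k)) atTop (𝓝 (φ xbar))

/-- The `φ`-attentive `ε`-localization of the limiting subdifferential around `(xbar, vbar)`. -/
def attentiveLocalization (φ : E → EReal) (xbar vbar : E) (ε : ℝ) (x : E) : Set E :=
  {v | v ∈ limitingSubdifferential φ x ∧ ‖v - vbar‖ < ε ∧ ‖x - xbar‖ < ε ∧
    φ xbar - (ε : EReal) < φ x ∧ φ x < φ xbar + (ε : EReal)}

/-- Convexity of an extended-real-valued function: its epigraph is convex. -/
def IsConvexEReal (ψ : E → EReal) : Prop :=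
  Convex ℝ {p : E × ℝ | ψ p.1 ≤ (p.2 : EReal)}

/-- Variational convexity of `φ` at `xbar` for `vbar`. -/
def IsVariationallyConvexAt (φ : E → EReal) (xbar vbar : E) : Prop :=
  ∃ U ∈ 𝓝 xbar, Convex ℝ U ∧ ∃ V ∈ 𝓝 vbar, Convex ℝ V ∧ ∃ ψ : E → EReal,
    (∀ x, ψ x ≠ ⊥) ∧ LowerSemicontinuous ψ ∧ IsConvexEReal ψ ∧ (∀ x ∈ U, ψ x ≤ φ x) ∧
    ∃ ε : ℝ, 0 < ε ∧
      ({x | x ∈ U ∧ φ x < φ xbar + (ε : EReal)} ×ˢ V) ∩ svGraph (limitingSubdifferential φ) =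
        (U ×ˢ V) ∩ svGraph (limitingSubdifferential ψ) ∧
      ∀ p ∈ (U ×ˢ V) ∩ svGraph (limitingSubdifferential ψ), φ p.1 = ψ p.1

end SubdifferentialTheory

/-! Local monotonicity of `∂φ` is read through the reflection `2P - id` of the resolvent `P = (I +
λT)⁻¹`, where `T` is the attentive localization: `T` is monotone near the point exactly when this
reflection is nonexpansive, and positive semidefiniteness of coderivatives is the infinitesimal form
of the same condition.

From (i), `T` has the germ of `∂ψ` with `ψ` convex. If `z` lies in the regular coderivative at `w`,
a local proximal minimization (`exists_local_resolvent`) finds graph increments `a`, `b` with `a + b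
= t(z - w)`. Monotonicity gives `‖a - b‖ ≤ ‖a + b‖`, and the coderivative inequality then yields `‖z
- w‖ ≤ ‖z + w‖`, that is `⟨z, w⟩ ≥ 0`. The sign survives limits, so limiting coderivatives inherit
it.

From (iii), prox-regularity with `λr ≤ 1/2` makes `P` single-valued and Lipschitz near `xbar + λ
vbar`. A proximal subgradient `ξ` of `⟨y, 2P - id⟩` produces a regular coderivative element of `T`,
whose sign forces `‖ξ‖ ≤ ‖y‖`. The mean value inequality
`le_add_mul_norm_of_proximal_subgradient_le` turns this into nonexpansiveness, so `T` is monotone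
along the resolvent (`inner_sub_nonneg_of_regularCoderivative_posSemidef`). Hence the Moreau
envelope is convex there, and the subgradients of `T` define affine minorants of `φ`
(`subgradient_inequality_of_monotone_resolvent`). Their supremum is `ψ`; uniqueness of resolvents
identifies the two graphs.

Under subdifferential continuity `T` and `∂φ` have the same germ, and regular coderivatives depend
only on the germ. -/

theorem EReal.eq_top_or_exists_coe {a : EReal} (h : a ≠ ⊥) : a = ⊤ ∨ ∃ b : ℝ, a = b := by
  induction a with
  | bot => exact absurd rfl h
  | top => exact Or.inl rfl
  | coe b => exact Or.inr ⟨b, rfl⟩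

theorem indicatorEReal_ne_bot {E : Type*} (Ω : Set E) (x : E) : indicatorEReal Ω x ≠ ⊥ := by
  unfold indicatorEReal; split_ifs <;> simp

theorem indicatorEReal_ne_top_iff {E : Type*} {Ω : Set E} {x : E} : indicatorEReal Ω x ≠ ⊤ ↔ x ∈ Ω := by
  unfold indicatorEReal; split_ifs with h <;> simp [h]

/-! ### Regular and limiting subdifferentials, normals and coderivatives. -/

section Subdifferentials

variable {E G : Type*} [NormedAddCommGroup E] [InnerProductSpace ℝ E]
  [NormedAddCommGroup G] [InnerProductSpace ℝ G]

/-- Replaces the quotient in `EReal` by a first-order estimate. At `u = x` the estimate is trivial,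
so the full neighbourhood filter can be used. -/
theorem mem_regularSubdifferential_iff {φ : E → EReal} (hbot : ∀ u, φ u ≠ ⊥) {x v : E} :
    v ∈ regularSubdifferential φ x ↔ φ x ≠ ⊤ ∧ ∀ η : ℝ, 0 < η → ∀ᶠ u in 𝓝 x,
      φ x + ((inner ℝ v (u - x) - η * ‖u - x‖ : ℝ) : EReal) ≤ φ u := by
  unfold regularSubdifferential
  rw [Set.mem_ofPred_eq]
  refine and_congr_right fun hx => ?_
  obtain ⟨a, ha⟩ := (EReal.eq_top_or_exists_coe (hbot x)).resolve_left hx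
  constructor
  · intro h η hη
    have h1 : ((-η : ℝ) : EReal) < liminf (fun u : E => (φ u - φ x -
        ((inner ℝ v (u - x) : ℝ) : EReal)) / ((‖u - x‖ : ℝ) : EReal)) (𝓝[≠] x) :=
      lt_of_lt_of_le (by exact_mod_cast neg_lt_zero.2 hη) h
    have h2 := eventually_nhdsWithin_iff.1 (eventually_lt_of_lt_liminf h1)
    filter_upwards [h2] with u hu
    by_cases hux : u = x
    · subst hux; simp
    · have hpos : 0 < ‖u - x‖ := norm_pos_iff.2 (sub_ne_zero.2 hux)
      specialize hu hux
      rcases EReal.eq_top_or_exists_coe (hbot u) with ht | ⟨b, hb⟩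
      · rw [ht]; exact le_top
      · rw [hb, ha] at hu
        rw [hb, ha]
        rw [← EReal.coe_sub, ← EReal.coe_sub, ← EReal.coe_div, EReal.coe_lt_coe_iff,
          lt_div_iff₀ hpos] at hu
        norm_cast
        linarith
  · intro h
    rw [← EReal.ge_of_forall_gt_iff_ge]
    intro c hc
    have hc' : c < 0 := by exact_mod_cast hc
    refine Filter.le_liminf_of_le (by isBoundedDefault) ?_
    filter_upwards [nhdsWithin_le_nhds (h (-c) (by linarith)), self_mem_nhdsWithin] with u hu hux
    have hpos : 0 < ‖u - x‖ := norm_pos_iff.2 (sub_ne_zero.2 hux)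
    rcases EReal.eq_top_or_exists_coe (hbot u) with ht | ⟨b, hb⟩
    · rw [ht, ha, EReal.top_sub_coe, EReal.top_sub_coe,
        EReal.top_div_of_pos_ne_top (by exact_mod_cast hpos) (EReal.coe_ne_top _)]
      exact le_top
    · rw [hb, ha] at hu
      rw [hb, ha, ← EReal.coe_sub, ← EReal.coe_sub, ← EReal.coe_div, EReal.coe_le_coe_iff,
        le_div_iff₀ hpos]
      norm_cast at hu
      linarith

theorem regularSubdifferential_subset_limitingSubdifferential {φ : E → EReal} {x : E} :
    regularSubdifferential φ x ⊆ limitingSubdifferential φ x := fun v hv =>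
  ⟨hv.1, fun _ => x, fun _ => v, tendsto_const_nhds, tendsto_const_nhds, tendsto_const_nhds,
    fun _ => hv⟩

/-- Proximal subgradients are regular subgradients. -/
theorem mem_regularSubdifferential_of_quadratic {φ : E → EReal} (hbot : ∀ u, φ u ≠ ⊥) {x v : E}
    (hx : φ x ≠ ⊤) (C : ℝ)
    (h : ∀ᶠ u in 𝓝 x, φ x + ((inner ℝ v (u - x) - C * ‖u - x‖ ^ 2 : ℝ) : EReal) ≤ φ u) :
    v ∈ regularSubdifferential φ x := by
  rw [mem_regularSubdifferential_iff hbot]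
  refine ⟨hx, fun η hη => ?_⟩
  have h2 : ∀ᶠ u in 𝓝 x, |C| * ‖u - x‖ < η := by
    have : Tendsto (fun u => |C| * ‖u - x‖) (𝓝 x) (𝓝 (|C| * ‖x - x‖)) :=
      (by fun_prop : Continuous fun u => |C| * ‖u - x‖).tendsto x
    rw [sub_self, norm_zero, mul_zero] at this
    exact this.eventually (gt_mem_nhds hη)
  filter_upwards [h, h2] with u hu hu2
  refine le_trans ?_ hu
  refine add_le_add le_rfl (EReal.coe_le_coe_iff.2 ?_)
  have := norm_nonneg (u - x)
  nlinarith [le_abs_self C, sq_nonneg ‖u - x‖]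

/-- The chord from `x` to `y` bounds `ψ` above at `x + t(y - x)`, the first-order estimate bounds it
below; dividing by `t` globalizes the inequality. -/
theorem regular_subgradient_inequality_of_convex {ψ : E → EReal} (hbot : ∀ u, ψ u ≠ ⊥)
    (hconv : IsConvexEReal ψ) {x v : E} (hv : v ∈ regularSubdifferential ψ x) (y : E) :
    ψ x + ((inner ℝ v (y - x) : ℝ) : EReal) ≤ ψ y := by
  obtain ⟨hx, h⟩ := (mem_regularSubdifferential_iff hbot).1 hv
  obtain ⟨a, ha⟩ := (EReal.eq_top_or_exists_coe (hbot x)).resolve_left hx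
  rcases EReal.eq_top_or_exists_coe (hbot y) with ht | ⟨b, hb⟩
  · rw [ht]; exact le_top
  rw [ha, hb]
  norm_cast
  refine le_of_forall_pos_le_add fun δ hδ => ?_
  -- The `+ 1` covers `y = x`; the accumulated error `η * ‖y - x‖` stays below `δ`.
  have hη : 0 < δ / (‖y - x‖ + 1) := by positivity
  have h1 := h _ hη
  have hlim : Tendsto (fun t : ℝ => x + t • (y - x)) (𝓝[>] 0) (𝓝 x) := by
    have : Tendsto (fun t : ℝ => x + t • (y - x)) (𝓝 0) (𝓝 (x + (0 : ℝ) • (y - x))) :=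
      (by fun_prop : Continuous fun t : ℝ => x + t • (y - x)).tendsto 0
    rw [zero_smul, add_zero] at this
    exact this.mono_left nhdsWithin_le_nhds
  have h2 := hlim.eventually h1
  have h3 : ∀ᶠ t : ℝ in 𝓝[>] 0, 0 < t ∧ t < 1 :=
    Ioo_mem_nhdsGT (by norm_num)
  obtain ⟨t, ht, ht0, ht1⟩ := (h2.and h3).exists
  have hc : ψ (x + t • (y - x)) ≤ ((a + t * (b - a) : ℝ) : EReal) := by
    have := hconv (x := (x, a)) (y := (y, b)) (by simp [ha]) (by simp [hb])
      (a := 1 - t) (b := t) (by linarith) ht0.le (by ring)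
    simp only [Prod.smul_mk, Prod.mk_add_mk, Set.mem_ofPred_eq] at this
    convert this using 2
    · module
    · simp only [smul_eq_mul]; ring
  have h4 := ht.trans hc
  rw [ha, ← EReal.coe_add, EReal.coe_le_coe_iff, add_sub_cancel_left, inner_smul_right,
    norm_smul, Real.norm_of_nonneg ht0.le] at h4
  have h5 : inner ℝ v (y - x) - δ / (‖y - x‖ + 1) * ‖y - x‖ ≤ b - a := by
    have : t * (inner ℝ v (y - x) - δ / (‖y - x‖ + 1) * ‖y - x‖) ≤ t * (b - a) := by linarith
    exact le_of_mul_le_mul_left this ht0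
  have h6 : δ / (‖y - x‖ + 1) * ‖y - x‖ ≤ δ := by
    rw [div_mul_eq_mul_div, div_le_iff₀ (by positivity)]
    nlinarith [norm_nonneg (y - x)]
  linarith

/-- Limiting subgradients of a convex function satisfy the global subgradient inequality. -/
theorem subgradient_inequality_of_convex {ψ : E → EReal} (hbot : ∀ u, ψ u ≠ ⊥)
    (hconv : IsConvexEReal ψ) {x v : E} (hv : v ∈ limitingSubdifferential ψ x) (y : E) :
    ψ x + ((inner ℝ v (y - x) : ℝ) : EReal) ≤ ψ y := by
  obtain ⟨hx, xs, vs, hxs, hψ, hvs, hreg⟩ := hv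
  have h1 : Tendsto (fun k => ψ (xs k) + ((inner ℝ (vs k) (y - xs k) : ℝ) : EReal)) atTop
      (𝓝 (ψ x + ((inner ℝ v (y - x) : ℝ) : EReal))) := by
    have hr : Tendsto (fun k => ((inner ℝ (vs k) (y - xs k) : ℝ) : EReal)) atTop
        (𝓝 ((inner ℝ v (y - x) : ℝ) : EReal)) :=
      (continuous_coe_real_ereal.tendsto _).comp (hvs.inner (tendsto_const_nhds.sub hxs))
    exact (EReal.continuousAt_add (p := (ψ x, ((inner ℝ v (y - x) : ℝ) : EReal)))
      (Or.inr (EReal.coe_ne_bot _)) (Or.inr (EReal.coe_ne_top _))).tendsto.comp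
      (hψ.prodMk_nhds hr)
  exact le_of_tendsto' h1 fun k =>
    regular_subgradient_inequality_of_convex hbot hconv (hreg k) y

/-- A global subgradient inequality gives a limiting subgradient. -/
theorem mem_limitingSubdifferential_of_inequality {ψ : E → EReal} (hbot : ∀ u, ψ u ≠ ⊥)
    {x v : E} (hx : ψ x ≠ ⊤) (h : ∀ y, ψ x + ((inner ℝ v (y - x) : ℝ) : EReal) ≤ ψ y) :
    v ∈ limitingSubdifferential ψ x :=
  regularSubdifferential_subset_limitingSubdifferential <|
    mem_regularSubdifferential_of_quadratic hbot hx 0 (Eventually.of_forall fun u => by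
      simpa using h u)

theorem subdifferential_monotone_of_convex {ψ : E → EReal} (hbot : ∀ u, ψ u ≠ ⊥)
    (hconv : IsConvexEReal ψ) {x v y w : E} (hv : v ∈ limitingSubdifferential ψ x)
    (hw : w ∈ limitingSubdifferential ψ y) : 0 ≤ inner ℝ (v - w) (x - y) := by
  have h1 := subgradient_inequality_of_convex hbot hconv hv y
  have h2 := subgradient_inequality_of_convex hbot hconv hw x
  obtain ⟨a, ha⟩ := (EReal.eq_top_or_exists_coe (hbot x)).resolve_left hv.1
  obtain ⟨b, hb⟩ := (EReal.eq_top_or_exists_coe (hbot y)).resolve_left hw.1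
  rw [ha, hb] at h1 h2
  norm_cast at h1 h2
  rw [inner_sub_left]
  rw [← neg_sub x y, inner_neg_right] at h1
  linarith

omit [InnerProductSpace ℝ E] [InnerProductSpace ℝ G] in
theorem norm_toLp_le (a : E) (b : G) : ‖WithLp.toLp 2 (a, b)‖ ≤ ‖a‖ + ‖b‖ := by
  have h := WithLp.prod_norm_sq_eq_of_L2 (WithLp.toLp 2 (a, b))
  change _ = ‖a‖ ^ 2 + ‖b‖ ^ 2 at h
  have ha := norm_nonneg a
  have hb := norm_nonneg b
  refine abs_le_of_sq_le_sq' ?_ (by positivity) |>.2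
  nlinarith

omit [InnerProductSpace ℝ E] [InnerProductSpace ℝ G] in
theorem add_norm_le_norm_toLp (a : E) (b : G) : ‖a‖ + ‖b‖ ≤ 2 * ‖WithLp.toLp 2 (a, b)‖ := by
  have h := WithLp.prod_norm_sq_eq_of_L2 (WithLp.toLp 2 (a, b))
  change _ = ‖a‖ ^ 2 + ‖b‖ ^ 2 at h
  have hc := norm_nonneg (WithLp.toLp 2 (a, b))
  refine abs_le_of_sq_le_sq' ?_ (by positivity) |>.2
  nlinarith [sq_nonneg (‖a‖ - ‖b‖), sq_nonneg ‖WithLp.toLp 2 (a, b)‖]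

theorem mem_regularNormalCone_iff {Ω : Set E} {x ν : E} :
    ν ∈ regularNormalCone Ω x ↔ x ∈ Ω ∧ ∀ η : ℝ, 0 < η → ∀ᶠ u in 𝓝 x, u ∈ Ω →
      inner ℝ ν (u - x) ≤ η * ‖u - x‖ := by
  unfold regularNormalCone
  rw [mem_regularSubdifferential_iff (indicatorEReal_ne_bot Ω), indicatorEReal_ne_top_iff]
  refine and_congr_right fun hx => forall₂_congr fun η _ => ?_
  refine eventually_congr (Eventually.of_forall fun u => ?_)
  by_cases hu : u ∈ Ω
  · simp only [indicatorEReal, hx, hu, if_true, zero_add, forall_const]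
    norm_cast
    exact sub_nonpos
  · simp [indicatorEReal, hu]

/-- The Euclidean product norm is equivalent to the sum of the norms, and the arbitrary `η` absorbs
the constant. -/
theorem mem_regularCoderivative_iff {F : E → Set G} {x : E} {y w : G} {z : E} :
    z ∈ regularCoderivative F x y w ↔ y ∈ F x ∧ ∀ η : ℝ, 0 < η → ∀ᶠ p in 𝓝 (x, y),
      p.2 ∈ F p.1 → inner ℝ z (p.1 - x) - inner ℝ w (p.2 - y) ≤
        η * (‖p.1 - x‖ + ‖p.2 - y‖) := by
  unfold regularCoderivative
  rw [Set.mem_ofPred_eq, mem_regularNormalCone_iff]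
  have hmap : 𝓝 (WithLp.toLp 2 (x, y)) = map (WithLp.toLp 2) (𝓝 (x, y)) :=
    ((WithLp.prodContinuousLinearEquiv 2 ℝ E G).symm.toHomeomorph.map_nhds_eq (x, y)).symm
  have hinner : ∀ p : E × G, inner ℝ (WithLp.toLp 2 (z, -w))
      (WithLp.toLp 2 p - WithLp.toLp 2 (x, y)) =
      inner ℝ z (p.1 - x) - inner ℝ w (p.2 - y) := fun p => by
    rw [WithLp.prod_inner_apply, ← sub_neg_eq_add, ← inner_neg_left]
    simp
  have hsub : ∀ p : E × G, WithLp.toLp 2 p - WithLp.toLp 2 (x, y) =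
      WithLp.toLp 2 (p.1 - x, p.2 - y) := fun p => rfl
  simp only [hmap, eventually_map]
  refine and_congr Iff.rfl ⟨fun h η hη => ?_, fun h η hη => ?_⟩
  · filter_upwards [h η hη] with p hp hpF
    have := hp hpF
    rw [hinner, hsub] at this
    exact this.trans (mul_le_mul_of_nonneg_left (norm_toLp_le _ _) hη.le)
  · filter_upwards [h (η / 2) (by positivity)] with p hp hpF
    rw [hinner, hsub]
    have h1 := add_norm_le_norm_toLp (p.1 - x) (p.2 - y)
    have := hp hpF
    nlinarith

/-- The regular coderivative depends only on the germ of the graph. -/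
theorem regularCoderivative_congr {F F' : E → Set G} {x : E} {y : G}
    (h : ∀ᶠ p in 𝓝 (x, y), p.2 ∈ F p.1 ↔ p.2 ∈ F' p.1) (w : G) :
    regularCoderivative F x y w = regularCoderivative F' x y w := by
  ext z
  rw [mem_regularCoderivative_iff, mem_regularCoderivative_iff]
  refine and_congr h.self_of_nhds (forall₂_congr fun η _ => ?_)
  refine eventually_congr ?_
  filter_upwards [h] with p hp
  rw [hp]

/-- Proximal normals to the graph are regular normals; proximal subgradients of resolvent
expressions give exactly such estimates. -/
theorem mem_regularCoderivative_of_quadratic {F : E → Set G} {x : E} {y w : G} {z : E}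
    (hy : y ∈ F x) (C : ℝ) (h : ∀ᶠ p in 𝓝 (x, y), p.2 ∈ F p.1 →
      inner ℝ z (p.1 - x) - inner ℝ w (p.2 - y) ≤ C * (‖p.1 - x‖ + ‖p.2 - y‖) ^ 2) :
    z ∈ regularCoderivative F x y w := by
  rw [mem_regularCoderivative_iff]
  refine ⟨hy, fun η hη => ?_⟩
  have h2 : ∀ᶠ p in 𝓝 (x, y), |C| * (‖p.1 - x‖ + ‖p.2 - y‖) < η := by
    have : Tendsto (fun p : E × G => |C| * (‖p.1 - x‖ + ‖p.2 - y‖)) (𝓝 (x, y))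
        (𝓝 (|C| * (‖x - x‖ + ‖y - y‖))) :=
      (by fun_prop : Continuous fun p : E × G => |C| * (‖p.1 - x‖ + ‖p.2 - y‖)).tendsto (x, y)
    rw [sub_self, sub_self, norm_zero, norm_zero, add_zero, mul_zero] at this
    exact this.eventually (gt_mem_nhds hη)
  filter_upwards [h, h2] with p hp hp2 hpF
  refine (hp hpF).trans ?_
  have h3 : 0 ≤ ‖p.1 - x‖ + ‖p.2 - y‖ := by positivity
  nlinarith [le_abs_self C, sq_nonneg (‖p.1 - x‖ + ‖p.2 - y‖)]

theorem regularCoderivative_subset_limitingCoderivative {F : E → Set G} {x : E} {y w : G} :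
    regularCoderivative F x y w ⊆ limitingCoderivative F x y w := fun _ hz =>
  regularSubdifferential_subset_limitingSubdifferential hz

/-- Positive semidefiniteness passes from regular to limiting coderivatives on open sets. -/
theorem limitingCoderivative_posSemidef {F : E → Set E} {O : Set (E × E)} (hO : IsOpen O)
    (h : ∀ x y, (x, y) ∈ O → ∀ w, ∀ z ∈ regularCoderivative F x y w, 0 ≤ inner ℝ z w)
    {x y : E} (hxy : (x, y) ∈ O) {w z : E} (hz : z ∈ limitingCoderivative F x y w) :
    0 ≤ inner ℝ z w := by
  obtain ⟨-, ps, vs, hps, -, hvs, hreg⟩ := hz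
  have hcont : Continuous (WithLp.ofLp : WithLp 2 (E × E) → E × E) :=
    (WithLp.prodContinuousLinearEquiv 2 ℝ E E).continuous
  have hp : Tendsto (fun k => (ps k).ofLp) atTop (𝓝 (x, y)) := (hcont.tendsto _).comp hps
  have hv : Tendsto (fun k => (vs k).ofLp) atTop (𝓝 (z, -w)) := (hcont.tendsto _).comp hvs
  have hlim : Tendsto (fun k => inner ℝ (vs k).ofLp.1 (-(vs k).ofLp.2)) atTop
      (𝓝 (inner ℝ z (- -w))) :=
    ((continuous_fst.tendsto _).comp hv).inner ((continuous_snd.tendsto _).comp hv).neg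
  rw [neg_neg] at hlim
  refine ge_of_tendsto hlim ?_
  filter_upwards [hp.eventually (hO.mem_nhds hxy)] with k hk
  refine h _ _ hk _ _ ?_
  unfold regularCoderivative
  rw [Set.mem_ofPred_eq, neg_neg]
  exact hreg k

end Subdifferentials

/-- A function on `[0, 1]` whose decrease is at most quadratic in the step does not decrease. -/
theorem le_of_forall_sub_mul_sq_le {f : ℝ → ℝ} {M : ℝ}
    (h : ∀ s t, 0 ≤ s → s ≤ t → t ≤ 1 → f s - M * (t - s) ^ 2 ≤ f t) : f 0 ≤ f 1 := by
  -- Over `N + 1` equal steps the losses sum to `M / (N + 1)`, which vanishes in the limit.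
  have h1 : ∀ N : ℕ, f 0 - M / ((N : ℝ) + 1) ≤ f 1 := by
    intro N
    have hN : (0 : ℝ) < (N : ℝ) + 1 := by positivity
    have h2 : ∀ k : ℕ, k ≤ N + 1 →
        f 0 - k * (M / ((N : ℝ) + 1) ^ 2) ≤ f ((k : ℝ) / ((N : ℝ) + 1)) := by
      intro k
      induction k with
      | zero => intro _; simp
      | succ k ih =>
        intro hk
        have h3 := ih (by omega)
        have h4 := h ((k : ℝ) / ((N : ℝ) + 1)) (((k + 1 : ℕ) : ℝ) / ((N : ℝ) + 1))
          (by positivity) (by gcongr; simp)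
          (by rw [div_le_one hN]; exact_mod_cast hk)
        have h5 : M * (((k + 1 : ℕ) : ℝ) / ((N : ℝ) + 1) - (k : ℝ) / ((N : ℝ) + 1)) ^ 2 =
            M / ((N : ℝ) + 1) ^ 2 := by
          push_cast; field_simp; ring
        rw [h5] at h4
        push_cast at h4 ⊢
        linarith
    have h3 := h2 (N + 1) le_rfl
    push_cast at h3
    rw [div_self hN.ne'] at h3
    have h4 : ((N : ℝ) + 1) * (M / ((N : ℝ) + 1) ^ 2) = M / ((N : ℝ) + 1) := by field_simp
    rwa [h4] at h3
  have hlim : Tendsto (fun N : ℕ => f 0 - M / ((N : ℝ) + 1)) atTop (𝓝 (f 0 - 0)) := by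
    refine tendsto_const_nhds.sub ?_
    have := (tendsto_one_div_add_atTop_nhds_zero_nat (𝕜 := ℝ)).const_mul M
    simpa [div_eq_mul_inv] using this
  rw [sub_zero] at hlim
  exact le_of_tendsto' hlim h1

/-! ### Proximal mean value inequality and local proximal minimization. -/

section Resolvent

variable {E : Type*} [NormedAddCommGroup E] [InnerProductSpace ℝ E]

/-- By AM-GM, `2‖x - b‖‖y - b‖ ≤ ‖x - b‖² + ‖y - b‖²`. This makes a norm penalty admissible in
proximal estimates away from its centre. -/
theorem norm_le_norm_add_quadratic {x y b : E} (hxb : x ≠ b) :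
    ‖y - b‖ ≤ ‖x - b‖ + inner ℝ (‖x - b‖⁻¹ • (x - b)) (y - x) +
      (2 * ‖x - b‖)⁻¹ * ‖y - x‖ ^ 2 := by
  have hpos : 0 < ‖x - b‖ := norm_pos_iff.2 (sub_ne_zero.2 hxb)
  have h1 : ‖y - b‖ ^ 2 = ‖x - b‖ ^ 2 + 2 * inner ℝ (x - b) (y - x) + ‖y - x‖ ^ 2 := by
    rw [← norm_add_sq_real]; congr 2; abel
  rw [real_inner_smul_left]
  have h2 : ‖x - b‖ + ‖x - b‖⁻¹ * inner ℝ (x - b) (y - x) + (2 * ‖x - b‖)⁻¹ * ‖y - x‖ ^ 2 =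
      (‖y - b‖ ^ 2 + ‖x - b‖ ^ 2) / (2 * ‖x - b‖) := by
    rw [h1]; field_simp; ring
  rw [h2, le_div_iff₀ (by positivity)]
  nlinarith [sq_nonneg (‖y - b‖ - ‖x - b‖)]

/-- A mean value inequality: a Lipschitz function on a ball all of whose proximal subgradients
have norm at most `K` is `K`-Lipschitz on a smaller ball. -/
theorem le_add_mul_norm_of_proximal_subgradient_le [ProperSpace E] {g : E → ℝ} {c : E}
    {R K L : ℝ} (hR : 0 < R) (hK : 0 ≤ K)
    (hL : ∀ x ∈ Metric.ball c R, ∀ y ∈ Metric.ball c R, |g x - g y| ≤ L * ‖x - y‖)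
    (hsub : ∀ x ∈ Metric.ball c R, ∀ (ξ : E) (C : ℝ),
      (∀ᶠ y in 𝓝 x, g x + inner ℝ ξ (y - x) - C * ‖y - x‖ ^ 2 ≤ g y) → ‖ξ‖ ≤ K)
    {a b : E} (ha : a ∈ Metric.ball c (R / 2)) (hb : b ∈ Metric.ball c (R / 2)) :
    g b ≤ g a + K * ‖b - a‖ := by
  -- Chosen so that `M * (R / 4) = |L|`: from distance `R / 4` on, the quadratic penalty dominates
  -- the Lipschitz variation of `g`.
  set M : ℝ := 4 * |L| / R with hM
  have hM0 : 0 ≤ M := by positivity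
  have hMR : M * (R / 4) = |L| := by rw [hM]; field_simp
  have hsubset : ∀ b ∈ Metric.ball c (R / 2), Metric.closedBall b (R / 4) ⊆ Metric.ball c R := by
    intro b hb x hx
    rw [Metric.mem_ball] at hb ⊢
    rw [Metric.mem_closedBall] at hx
    linarith [dist_triangle x b c]
  have hcont : ContinuousOn g (Metric.ball c R) := by
    refine LipschitzOnWith.continuousOn (K := L.toNNReal) ?_
    refine LipschitzOnWith.of_dist_le_mul fun x hx y hy => ?_
    rw [Real.dist_eq, dist_eq_norm]
    exact (hL x hx y hy).trans
      (mul_le_mul_of_nonneg_right (Real.le_coe_toNNReal L) (norm_nonneg _))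
  have step : ∀ b ∈ Metric.ball c (R / 2), ∀ x ∈ Metric.ball c (R / 2),
      g b ≤ g x + K * ‖x - b‖ + M * ‖x - b‖ ^ 2 := by
    intro b hb x hx
    have hball : ∀ x ∈ Metric.ball c (R / 2), x ∈ Metric.ball c R := fun x hx =>
      Metric.ball_subset_ball (by linarith) hx
    rcases lt_or_ge (R / 4) ‖x - b‖ with hfar | hnear
    · have h1 := (le_abs_self _).trans (hL b (hball b hb) x (hball x hx))
      rw [norm_sub_rev b x] at h1
      have h2 := norm_nonneg (x - b)
      have h3 : L * ‖x - b‖ ≤ M * ‖x - b‖ ^ 2 := by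
        have : L ≤ M * ‖x - b‖ := by
          calc L ≤ |L| := le_abs_self L
            _ = M * (R / 4) := hMR.symm
            _ ≤ M * ‖x - b‖ := by gcongr
        nlinarith
      have := mul_nonneg hK h2
      linarith
    · refine le_of_forall_pos_le_add fun δ hδ => ?_
      -- With slope strictly above `K`, a minimizer `m ≠ b` of the penalized function would carry a
      -- proximal subgradient of norm `K' + 2M‖m - b‖ > K`. Hence the minimizer is `b`.
      set K' := K + δ / (‖x - b‖ + 1) with hK'
      have hKK' : K < K' := by rw [hK']; have : 0 < δ / (‖x - b‖ + 1) := by positivity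
                               linarith
      obtain ⟨m, hm, hmin⟩ := (isCompact_closedBall b (R / 4)).exists_isMinOn
        ⟨b, Metric.mem_closedBall_self (by positivity)⟩
        (f := fun x => g x + K' * ‖x - b‖ + M * ‖x - b‖ ^ 2)
        (((hcont.mono (hsubset b hb)).add (by fun_prop)).add (by fun_prop))
      have hmb := hmin (Metric.mem_closedBall_self (by positivity : 0 ≤ R / 4))
      simp only [Set.mem_ofPred_eq, sub_self, norm_zero, mul_zero, add_zero, ne_eq,
        OfNat.ofNat_ne_zero, not_false_eq_true, zero_pow] at hmb
      have hmb0 : m = b := by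
        by_contra hne
        have hpos : 0 < ‖m - b‖ := norm_pos_iff.2 (sub_ne_zero.2 hne)
        have hm' : ‖m - b‖ ≤ R / 4 := by rwa [← dist_eq_norm]
        have hlt : ‖m - b‖ < R / 4 := by
          refine lt_of_le_of_ne hm' fun heq => ?_
          have h1 := (le_abs_self _).trans (hL b (hball b hb) m (hsubset b hb hm))
          rw [norm_sub_rev b m] at h1
          have h2 : L * ‖m - b‖ ≤ M * ‖m - b‖ ^ 2 := by
            rw [pow_two, ← mul_assoc]
            refine mul_le_mul_of_nonneg_right ?_ hpos.le
            rw [heq, hMR]; exact le_abs_self L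
          have h3 : 0 < K' * ‖m - b‖ := mul_pos (by linarith) hpos
          linarith
        have hnb : ∀ᶠ y in 𝓝 m, y ∈ Metric.closedBall b (R / 4) := by
          filter_upwards [Metric.isOpen_ball.mem_nhds
            (show m ∈ Metric.ball b (R / 4) by rwa [Metric.mem_ball, dist_eq_norm])] with y hy
          exact Metric.ball_subset_closedBall hy
        have hb1 := hsub m (hsubset b hb hm)
          (-((K' * ‖m - b‖⁻¹ + 2 * M) • (m - b))) (K' * (2 * ‖m - b‖)⁻¹ + M) (by
            filter_upwards [hnb] with y hy
            have h1 : g m + K' * ‖m - b‖ + M * ‖m - b‖ ^ 2 ≤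
              g y + K' * ‖y - b‖ + M * ‖y - b‖ ^ 2 := hmin hy
            have h2 := mul_le_mul_of_nonneg_left (norm_le_norm_add_quadratic (y := y) hne)
              (show 0 ≤ K' by linarith)
            have h3 : ‖y - b‖ ^ 2 =
                ‖m - b‖ ^ 2 + 2 * inner ℝ (m - b) (y - m) + ‖y - m‖ ^ 2 := by
              rw [← norm_add_sq_real]; congr 2; abel
            rw [real_inner_smul_left] at h2
            rw [inner_neg_left, real_inner_smul_left]
            rw [h3] at h1
            linarith)
        rw [norm_neg, norm_smul, Real.norm_of_nonneg (by
          have : 0 ≤ K' := by linarith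
          positivity), add_mul, mul_assoc, inv_mul_cancel₀ hpos.ne', mul_one] at hb1
        have : 0 ≤ 2 * M * ‖m - b‖ := by positivity
        linarith
      have hx' := hmin (show x ∈ Metric.closedBall b (R / 4) by
        rwa [Metric.mem_closedBall, dist_eq_norm])
      simp only [Set.mem_ofPred_eq, hmb0, sub_self, norm_zero, mul_zero, add_zero, ne_eq,
        OfNat.ofNat_ne_zero, not_false_eq_true, zero_pow] at hx'
      have h6 : δ / (‖x - b‖ + 1) * ‖x - b‖ ≤ δ := by
        rw [div_mul_eq_mul_div, div_le_iff₀ (by positivity)]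
        nlinarith [norm_nonneg (x - b)]
      rw [hK', add_mul] at hx'
      linarith
  have hseg : ∀ t : ℝ, 0 ≤ t → t ≤ 1 → a + t • (b - a) ∈ Metric.ball c (R / 2) :=
    fun t h0 h1 => (convex_ball c (R / 2)).add_smul_sub_mem ha hb ⟨h0, h1⟩
  -- Subdividing the segment removes the quadratic error of `step`.
  have := le_of_forall_sub_mul_sq_le (f := fun t => t * (K * ‖b - a‖) - g (a + t • (b - a)))
    (M := M * ‖b - a‖ ^ 2) (by
      intro s t hs hst ht
      have h1 := step _ (hseg t (hs.trans hst) ht) _ (hseg s hs (hst.trans ht))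
      have h2 : a + s • (b - a) - (a + t • (b - a)) = -((t - s) • (b - a)) := by module
      rw [h2, norm_neg, norm_smul, Real.norm_of_nonneg (by linarith)] at h1
      nlinarith)
  simp only [zero_mul, zero_smul, add_zero, one_mul, one_smul, add_sub_cancel] at this
  linarith

omit [InnerProductSpace ℝ E] in
theorem lowerSemicontinuous_add_coe {φ : E → EReal} (hlsc : LowerSemicontinuous φ)
    {g : E → ℝ} (hg : Continuous g) : LowerSemicontinuous fun x => φ x + (g x : EReal) :=
  hlsc.add' (continuous_coe_real_ereal.comp hg).lowerSemicontinuous fun _ =>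
    EReal.continuousAt_add (Or.inr (EReal.coe_ne_bot _)) (Or.inr (EReal.coe_ne_top _))

/-- If `φ` has a proximal subgradient `v₀` at `x₀`, then near `x₀ + lam • v₀` the resolvent of
its subdifferential is obtained by a local proximal minimization. -/
theorem exists_local_resolvent [ProperSpace E] {φ : E → EReal} (hbot : ∀ u, φ u ≠ ⊥)
    (hlsc : LowerSemicontinuous φ) {x₀ v₀ : E} (hx₀ : φ x₀ ≠ ⊤) {ε r lam : ℝ} (hε : 0 < ε)
    (hr : 0 ≤ r) (hlam : 0 < lam) (hlr : lam * r ≤ 1 / 2)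
    (hq : ∀ x, ‖x - x₀‖ < ε →
      φ x₀ + ((inner ℝ v₀ (x - x₀) - r / 2 * ‖x - x₀‖ ^ 2 : ℝ) : EReal) ≤ φ x)
    {η : ℝ} (hη : 0 < η) :
    ∃ δ > 0, ∀ s, ‖s - (x₀ + lam • v₀)‖ < δ → ∃ x v, x + lam • v = s ∧ ‖x - x₀‖ < η ∧
      ‖v - v₀‖ < η ∧ v ∈ regularSubdifferential φ x ∧ φ x₀ - (η : EReal) < φ x ∧
      φ x < φ x₀ + (η : EReal) ∧
      ∀ y, ‖y - x₀‖ < ε / 2 → φ x + ((lam / 2 * ‖v‖ ^ 2 : ℝ) : EReal) ≤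
        φ y + (((2 * lam)⁻¹ * ‖y - s‖ ^ 2 : ℝ) : EReal) := by
  obtain ⟨a₀, ha₀⟩ := (EReal.eq_top_or_exists_coe (hbot x₀)).resolve_left hx₀
  have small : ∀ f : ℝ → ℝ, Continuous f → f 0 = 0 → ∀ κ > 0, ∀ᶠ t in 𝓝 (0 : ℝ), f t < κ :=
    fun f hf h0 κ hκ => (hf.tendsto 0).eventually (gt_mem_nhds (by rwa [h0]))
  -- With `t = ‖h‖`, the size of the perturbation of `s`, these bounds control the distance to `x₀`,
  -- interiority of the minimizer, `v - v₀`, and the upper and lower values of `φ`.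
  have hev := ((((small (fun t => 4 * t) (by fun_prop) (by simp) η hη).and
    (small (fun t => 4 * t) (by fun_prop) (by simp) (ε / 2) (by positivity))).and
    (small (fun t => lam⁻¹ * (5 * t)) (by fun_prop) (by simp) η hη)).and
    (small (fun t => (2 * lam)⁻¹ * (4 * t * (2 * (lam * ‖v₀‖ + t) + 4 * t))) (by fun_prop)
      (by simp) η hη)).and
    (small (fun t => ‖v₀‖ * (4 * t) + r / 2 * (4 * t) ^ 2) (by fun_prop) (by simp) η hη)
  obtain ⟨δ, hδ, hδ'⟩ := Metric.eventually_nhds_iff.1 hev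
  refine ⟨δ, hδ, fun s hs => ?_⟩
  set h := s - (x₀ + lam • v₀) with hh
  obtain ⟨⟨⟨⟨b1, b2⟩, b3⟩, b4⟩, b5⟩ := hδ' (y := ‖h‖) (by simpa using hs)
  obtain ⟨x, hx, hmin⟩ := LowerSemicontinuousOn.exists_isMinOn
    (f := fun y => φ y + (((2 * lam)⁻¹ * ‖y - s‖ ^ 2 : ℝ) : EReal))
    (s := Metric.closedBall x₀ (ε / 2)) ⟨x₀, Metric.mem_closedBall_self (by positivity)⟩
    (isCompact_closedBall _ _)
    ((lowerSemicontinuous_add_coe hlsc (by fun_prop)).lowerSemicontinuousOn _)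
  have hmin' : ∀ y, ‖y - x₀‖ ≤ ε / 2 → φ x + (((2 * lam)⁻¹ * ‖x - s‖ ^ 2 : ℝ) : EReal) ≤
      φ y + (((2 * lam)⁻¹ * ‖y - s‖ ^ 2 : ℝ) : EReal) := fun y hy =>
    hmin (show y ∈ Metric.closedBall x₀ (ε / 2) by rwa [Metric.mem_closedBall, dist_eq_norm])
  have hxε : ‖x - x₀‖ ≤ ε / 2 := by rwa [← dist_eq_norm]
  have hx0 := hmin' x₀ (by simp; positivity)
  have hxtop : φ x ≠ ⊤ := by
    intro ht
    rw [ht, ha₀, EReal.top_add_coe, ← EReal.coe_add] at hx0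
    exact absurd hx0 (not_le.2 (EReal.coe_lt_top _))
  obtain ⟨a, ha⟩ := (EReal.eq_top_or_exists_coe (hbot x)).resolve_left hxtop
  have hqx := hq x (by linarith)
  rw [ha, ha₀] at hx0 hqx
  norm_cast at hx0 hqx
  have hlam2 : 0 < (2 * lam)⁻¹ := by positivity
  set d := ‖x - x₀‖ with hd
  have hd0 : 0 ≤ d := norm_nonneg _
  have hexp : ‖x - s‖ ^ 2 - ‖x₀ - s‖ ^ 2 =
      d ^ 2 - 2 * lam * inner ℝ v₀ (x - x₀) - 2 * inner ℝ h (x - x₀) := by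
    have e1 : ‖x - s‖ ^ 2 = ‖x - x₀‖ ^ 2 + 2 * inner ℝ (x - x₀) (x₀ - s) + ‖x₀ - s‖ ^ 2 := by
      rw [← norm_add_sq_real]; congr 2; abel
    have e2 : x₀ - s = -(lam • v₀ + h) := by rw [hh]; module
    rw [e1, ← hd]
    nth_rewrite 1 [e2]
    rw [inner_neg_right, inner_add_right, inner_smul_right, real_inner_comm, real_inner_comm h]
    ring
  -- Comparing the minimizer with `x₀` cancels the `v₀` terms and leaves `(1 - lam * r) d² ≤ 2‖h‖
  -- d`; here `lam * r ≤ 1 / 2` enters.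
  have hdh : d ≤ 4 * ‖h‖ := by
    have hi := real_inner_le_norm h (x - x₀)
    rw [← hd] at hi
    have k1 : (2 * lam)⁻¹ * (d ^ 2 - 2 * lam * inner ℝ v₀ (x - x₀) - 2 * inner ℝ h (x - x₀)) ≤
        -(inner ℝ v₀ (x - x₀) - r / 2 * d ^ 2) := by
      rw [← hexp]; linarith
    have k2 := mul_le_mul_of_nonneg_left k1 (show 0 ≤ 2 * lam by positivity)
    rw [← mul_assoc, mul_inv_cancel₀ (by positivity), one_mul] at k2
    have k3 : d ^ 2 / 2 ≤ 2 * ‖h‖ * d := by nlinarith [sq_nonneg d]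
    by_contra hcon
    push Not at hcon
    have : 0 < d := lt_of_le_of_lt (by positivity) hcon
    nlinarith
  have hv : x + lam • (lam⁻¹ • (s - x)) = s := by
    rw [smul_smul, mul_inv_cancel₀ hlam.ne', one_smul]; abel
  set v := lam⁻¹ • (s - x) with hvdef
  have hxs : x - s = -(lam • v) := by rw [← hv]; abel
  have hvn : (2 * lam)⁻¹ * ‖x - s‖ ^ 2 = lam / 2 * ‖v‖ ^ 2 := by
    rw [hxs, norm_neg, norm_smul, Real.norm_of_nonneg hlam.le]; field_simp
  refine ⟨x, v, hv, by linarith, ?_, ?_, ?_, ?_, ?_⟩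
  · have e : v - v₀ = lam⁻¹ • (h - (x - x₀)) := by
      rw [hvdef, hh, smul_sub, smul_sub, smul_sub, smul_add, smul_smul, inv_mul_cancel₀ hlam.ne',
        one_smul, smul_sub]; abel
    rw [e, norm_smul, Real.norm_of_nonneg (by positivity)]
    refine lt_of_le_of_lt (mul_le_mul_of_nonneg_left ?_ (by positivity)) b3
    linarith [norm_sub_le h (x - x₀)]
  · refine mem_regularSubdifferential_of_quadratic hbot hxtop (2 * lam)⁻¹ ?_
    have : ∀ᶠ y in 𝓝 x, y ∈ Metric.ball x₀ (ε / 2) :=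
      Metric.isOpen_ball.mem_nhds (by rw [Metric.mem_ball, dist_eq_norm]; linarith)
    filter_upwards [this] with y hy
    rw [Metric.mem_ball, dist_eq_norm] at hy
    have h1 := hmin' y hy.le
    rcases EReal.eq_top_or_exists_coe (hbot y) with ht | ⟨b, hb⟩
    · rw [ht]; exact le_top
    rw [ha, hb] at h1 ⊢
    norm_cast at h1 ⊢
    have e1 : ‖y - s‖ ^ 2 = ‖y - x‖ ^ 2 + 2 * inner ℝ (y - x) (x - s) + ‖x - s‖ ^ 2 := by
      rw [← norm_add_sq_real]; congr 2; abel
    have e2 : inner ℝ (y - x) (x - s) = -(lam * inner ℝ v (y - x)) := by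
      rw [hxs, inner_neg_right, inner_smul_right, real_inner_comm]
    rw [e1, e2] at h1
    have e3 : (2 * lam)⁻¹ * (‖y - x‖ ^ 2 + 2 * -(lam * inner ℝ v (y - x)) + ‖x - s‖ ^ 2) =
      (2 * lam)⁻¹ * ‖y - x‖ ^ 2 - inner ℝ v (y - x) + (2 * lam)⁻¹ * ‖x - s‖ ^ 2 := by
      field_simp; ring
    linarith
  · rw [ha, ha₀]
    norm_cast
    have h1 := neg_le_of_abs_le (abs_real_inner_le_norm v₀ (x - x₀))
    rw [← hd] at h1
    have h2 : ‖v₀‖ * d ≤ ‖v₀‖ * (4 * ‖h‖) := by gcongr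
    have h3 : r / 2 * d ^ 2 ≤ r / 2 * (4 * ‖h‖) ^ 2 := by gcongr
    linarith
  · rw [ha, ha₀]
    norm_cast
    have h1 : ‖x₀ - s‖ ≤ lam * ‖v₀‖ + ‖h‖ := by
      have e2 : x₀ - s = -(lam • v₀ + h) := by rw [hh]; module
      rw [e2, norm_neg]
      refine (norm_add_le _ _).trans_eq ?_
      rw [norm_smul, Real.norm_of_nonneg hlam.le]
    have h2 : ‖x₀ - s‖ ≤ d + ‖x - s‖ := by
      have := norm_add_le (x₀ - x) (x - s)
      rwa [sub_add_sub_cancel, norm_sub_rev x₀ x] at this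
    have h3 : ‖x - s‖ ≤ d + ‖x₀ - s‖ := by
      have := norm_add_le (x - x₀) (x₀ - s)
      rwa [sub_add_sub_cancel] at this
    have h4 : ‖x₀ - s‖ ^ 2 - ‖x - s‖ ^ 2 ≤
        4 * ‖h‖ * (2 * (lam * ‖v₀‖ + ‖h‖) + 4 * ‖h‖) := by
      have n1 := norm_nonneg (x₀ - s)
      have n2 := norm_nonneg (x - s)
      have n3 : ‖x₀ - s‖ + ‖x - s‖ ≤ 2 * (lam * ‖v₀‖ + ‖h‖) + 4 * ‖h‖ := by linarith
      calc ‖x₀ - s‖ ^ 2 - ‖x - s‖ ^ 2 = (‖x₀ - s‖ - ‖x - s‖) * (‖x₀ - s‖ + ‖x - s‖) := by ring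
        _ ≤ (4 * ‖h‖) * (‖x₀ - s‖ + ‖x - s‖) := by gcongr; linarith
        _ ≤ _ := by gcongr
    have h5 := mul_le_mul_of_nonneg_left h4 hlam2.le
    rw [mul_sub] at h5
    linarith
  · intro y hy
    rw [← hvn]
    exact hmin' y hy.le

end Resolvent

/-! ### From variational convexity to positive semidefinite coderivatives. -/

section Convexity

variable {E : Type*} [NormedAddCommGroup E] [InnerProductSpace ℝ E]

/-- Polarization: the link between nonexpansive reflections and signs of inner products, used for
coderivatives and for the resolvent alike. -/
theorem inner_nonneg_of_norm_sub_le_norm_add {z w : E} (h : ‖z - w‖ ≤ ‖z + w‖) :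
    0 ≤ inner ℝ z w := by
  have h1 := norm_sub_sq_real z w
  have h2 := norm_add_sq_real z w
  have h3 := norm_nonneg (z - w)
  nlinarith

/-- The subdifferential of a convex function has positive semidefinite regular coderivatives. -/
theorem regularCoderivative_subdifferential_posSemidef [ProperSpace E] {ψ : E → EReal}
    (hbot : ∀ u, ψ u ≠ ⊥) (hlsc : LowerSemicontinuous ψ) (hconv : IsConvexEReal ψ)
    {u v w z : E} (hz : z ∈ regularCoderivative (limitingSubdifferential ψ) u v w) :
    0 ≤ inner ℝ z w := by
  obtain ⟨hv, hz⟩ := mem_regularCoderivative_iff.1 hz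
  refine inner_nonneg_of_norm_sub_le_norm_add (le_of_forall_pos_le_add fun ρ hρ => ?_)
  rcases eq_or_ne (z - w) 0 with hd | hd
  · rw [hd, norm_zero]; positivity
  have hd0 : 0 < ‖z - w‖ := norm_pos_iff.2 hd
  obtain ⟨κ, hκ, hκ'⟩ := Metric.eventually_nhds_iff.1 (hz (ρ / 4) (by positivity))
  obtain ⟨δ, hδ, hδ'⟩ := exists_local_resolvent (r := 0) (lam := 1) (ε := 1) hbot hlsc hv.1
    one_pos le_rfl one_pos (by norm_num) (fun x _ => by
      simpa using subgradient_inequality_of_convex hbot hconv hv x) one_pos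
  -- Small enough both for solvability of the resolvent equation (`δ`) and for the coderivative
  -- inequality (`κ`).
  set t := min δ κ / (2 * ‖z - w‖) with ht
  have hmin : 0 < min δ κ := lt_min hδ hκ
  have ht0 : 0 < t := by positivity
  have htd : t * ‖z - w‖ < min δ κ := by
    have : t * ‖z - w‖ = min δ κ / 2 := by rw [ht]; field_simp
    linarith
  obtain ⟨x, y, hxy, -, -, hy, -⟩ := hδ' (u + (1 : ℝ) • v + t • (z - w)) (by
    rw [add_sub_cancel_left, norm_smul, Real.norm_of_nonneg ht0.le]
    exact htd.trans_le (min_le_left _ _))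
  have hmono := subdifferential_monotone_of_convex hbot hconv
    (regularSubdifferential_subset_limitingSubdifferential hy) hv
  have hab : (x - u) + (y - v) = t • (z - w) := by
    rw [one_smul, one_smul] at hxy
    rw [← add_sub_add_comm, hxy]; abel
  set a := x - u
  set b := y - v
  have hsq := norm_add_sq_real a b
  have hsq' := norm_sub_sq_real a b
  have hnab : ‖a + b‖ = t * ‖z - w‖ := by rw [hab, norm_smul, Real.norm_of_nonneg ht0.le]
  rw [real_inner_comm] at hmono
  have hna := norm_nonneg a
  have hnb := norm_nonneg b
  have hnn := norm_nonneg (a + b)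
  have hab1 : ‖a‖ ≤ ‖a + b‖ := abs_le_of_sq_le_sq' (by nlinarith) hnn |>.2
  have hab2 : ‖b‖ ≤ ‖a + b‖ := abs_le_of_sq_le_sq' (by nlinarith) hnn |>.2
  have hab3 : ‖a - b‖ ≤ ‖a + b‖ := abs_le_of_sq_le_sq' (by nlinarith) hnn |>.2
  have key := hκ' (y := (x, y)) (by
    rw [Prod.dist_eq, dist_eq_norm, dist_eq_norm]
    exact max_lt (by linarith [min_le_right δ κ]) (by linarith [min_le_right δ κ]))
    (regularSubdifferential_subset_limitingSubdifferential hy)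
  change inner ℝ z a - inner ℝ w b ≤ ρ / 4 * (‖a‖ + ‖b‖) at key
  -- In the coordinates `a + b`, `a - b` the first term is at least `-‖z + w‖‖a + b‖` by
  -- monotonicity, while the second is exactly `‖z - w‖‖a + b‖`.
  have hid : inner ℝ z a - inner ℝ w b =
      (inner ℝ (z + w) (a - b) + inner ℝ (z - w) (a + b)) / 2 := by
    simp only [inner_add_left, inner_sub_left, inner_add_right, inner_sub_right]; ring
  have h1 : inner ℝ (z - w) (a + b) = ‖z - w‖ * ‖a + b‖ := by
    rw [hab, inner_smul_right, real_inner_self_eq_norm_sq, norm_smul,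
      Real.norm_of_nonneg ht0.le]; ring
  have h2 := neg_le_of_abs_le (abs_real_inner_le_norm (z + w) (a - b))
  have h3 : ‖z + w‖ * ‖a - b‖ ≤ ‖z + w‖ * ‖a + b‖ := by gcongr
  have h4 : ρ / 4 * (‖a‖ + ‖b‖) ≤ ρ / 4 * (2 * ‖a + b‖) := by gcongr; linarith
  have hpos : 0 < ‖a + b‖ := by rw [hnab]; positivity
  rw [hid, h1] at key
  have : ‖z - w‖ * ‖a + b‖ ≤ (‖z + w‖ + ρ) * ‖a + b‖ := by linarith
  exact le_of_mul_le_mul_right this hpos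

/-- A set-valued mapping which agrees locally with the subdifferential of a convex function has
positive semidefinite limiting coderivatives. -/
theorem limitingCoderivative_posSemidef_of_germ [ProperSpace E] {ψ : E → EReal}
    (hbot : ∀ u, ψ u ≠ ⊥) (hlsc : LowerSemicontinuous ψ) (hconv : IsConvexEReal ψ)
    {F : E → Set E} {q : E × E}
    (h : ∀ᶠ p in 𝓝 q, p.2 ∈ F p.1 ↔ p.2 ∈ limitingSubdifferential ψ p.1) :
    ∃ W ∈ 𝓝 q, ∀ u v, (u, v) ∈ W → ∀ w, ∀ z ∈ limitingCoderivative F u v w,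
      0 ≤ inner ℝ z w := by
  obtain ⟨O, hO, hOopen, hq⟩ := eventually_nhds_iff.1 h
  refine ⟨O, hOopen.mem_nhds hq, fun u v huv w z hz =>
    limitingCoderivative_posSemidef hOopen (fun x y hxy w z hz => ?_) huv hz⟩
  rw [regularCoderivative_congr (F' := limitingSubdifferential ψ)
    (by filter_upwards [hOopen.mem_nhds hxy] with p hp using hO p hp)] at hz
  exact regularCoderivative_subdifferential_posSemidef hbot hlsc hconv hz

/-- Under variational convexity, the attentive localization agrees locally with the
subdifferential of a convex function. -/
theorem IsVariationallyConvexAt.exists_convex_germ {φ : E → EReal}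
    (hbot : ∀ u, φ u ≠ ⊥) (hlsc : LowerSemicontinuous φ) {xbar vbar : E}
    (hv : vbar ∈ limitingSubdifferential φ xbar) (h : IsVariationallyConvexAt φ xbar vbar) :
    ∃ ψ : E → EReal, (∀ u, ψ u ≠ ⊥) ∧ LowerSemicontinuous ψ ∧ IsConvexEReal ψ ∧
      ∃ ε : ℝ, 0 < ε ∧ ProxRegularInequality φ xbar vbar ε 0 ∧
        ∀ᶠ p in 𝓝 (xbar, vbar), p.2 ∈ attentiveLocalization φ xbar vbar ε p.1 ↔
          p.2 ∈ limitingSubdifferential ψ p.1 := by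
  obtain ⟨U, hU, -, V, hV, -, ψ, hψbot, hψlsc, hψconv, hle, ε₀, hε₀, hgph, heq⟩ := h
  obtain ⟨η₁, hη₁, hU'⟩ := Metric.mem_nhds_iff.1 hU
  obtain ⟨η₂, hη₂, hV'⟩ := Metric.mem_nhds_iff.1 hV
  obtain ⟨a, ha⟩ := (EReal.eq_top_or_exists_coe (hbot xbar)).resolve_left hv.1
  set ε := min ε₀ (min η₁ η₂) with hε
  have hε0 : 0 < ε := lt_min hε₀ (lt_min hη₁ hη₂)
  have memU : ∀ x, ‖x - xbar‖ < ε → x ∈ U := fun x hx => hU' <| by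
    rw [Metric.mem_ball, dist_eq_norm]
    exact hx.trans_le ((min_le_right _ _).trans (min_le_left _ _))
  have memV : ∀ x, ‖x - vbar‖ < ε → x ∈ V := fun x hx => hV' <| by
    rw [Metric.mem_ball, dist_eq_norm]
    exact hx.trans_le ((min_le_right _ _).trans (min_le_right _ _))
  have hεle : φ xbar + (ε : EReal) ≤ φ xbar + (ε₀ : EReal) :=
    add_le_add le_rfl (by exact_mod_cast min_le_left _ _)
  have tomem : ∀ u v, ‖u - xbar‖ < ε → ‖v - vbar‖ < ε → φ u < φ xbar + (ε : EReal) →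
      v ∈ limitingSubdifferential φ u → v ∈ limitingSubdifferential ψ u ∧ φ u = ψ u := by
    intro u v hu hv hφ hvu
    have hmem : (u, v) ∈ ({x | x ∈ U ∧ φ x < φ xbar + (ε₀ : EReal)} ×ˢ V) ∩
        svGraph (limitingSubdifferential φ) :=
      ⟨⟨⟨memU u hu, hφ.trans_le hεle⟩, memV v hv⟩, hvu⟩
    rw [hgph] at hmem
    exact ⟨hmem.2, heq _ hmem⟩
  have frommem : ∀ u v, ‖u - xbar‖ < ε → ‖v - vbar‖ < ε →
      v ∈ limitingSubdifferential ψ u → v ∈ limitingSubdifferential φ u ∧ φ u = ψ u := by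
    intro u v hu hv hvu
    have hmem : (u, v) ∈ (U ×ˢ V) ∩ svGraph (limitingSubdifferential ψ) :=
      ⟨⟨memU u hu, memV v hv⟩, hvu⟩
    refine ⟨?_, heq _ hmem⟩
    rw [← hgph] at hmem
    exact hmem.2
  have hbar : φ xbar = ψ xbar := (tomem xbar vbar (by simpa) (by simpa) (by
    rw [ha, ← EReal.coe_add, EReal.coe_lt_coe_iff]; linarith) hv).2
  refine ⟨ψ, hψbot, hψlsc, hψconv, ε, hε0, ?_, ?_⟩
  · intro x u v hx hu hv hφ hvu
    obtain ⟨h1, h2⟩ := tomem u v hu hv hφ hvu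
    have h3 := (subgradient_inequality_of_convex hψbot hψconv h1 x).trans (hle x (memU x hx))
    rw [h2]
    simpa using h3
  · have e1 : ∀ᶠ p : E × E in 𝓝 (xbar, vbar), ‖p.1 - xbar‖ < ε :=
      ((by fun_prop : Continuous fun p : E × E => ‖p.1 - xbar‖).tendsto (xbar, vbar)).eventually
        (gt_mem_nhds (by simpa))
    have e2 : ∀ᶠ p : E × E in 𝓝 (xbar, vbar), ‖p.2 - vbar‖ < ε :=
      ((by fun_prop : Continuous fun p : E × E => ‖p.2 - vbar‖).tendsto (xbar, vbar)).eventually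
        (gt_mem_nhds (by simpa))
    -- The upper bound on `φ p.1` comes from testing the subgradient inequality of `ψ` at `xbar`;
    -- the lower bound is semicontinuity.
    have e3 : ∀ᶠ p : E × E in 𝓝 (xbar, vbar), -ε < inner ℝ p.2 (xbar - p.1) :=
      ((by fun_prop : Continuous fun p : E × E =>
        (inner ℝ p.2 (xbar - p.1) : ℝ)).tendsto (xbar, vbar)).eventually
        (lt_mem_nhds (by simpa))
    have e4 : ∀ᶠ p : E × E in 𝓝 (xbar, vbar), φ xbar - (ε : EReal) < φ p.1 :=
      (continuous_fst.tendsto (xbar, vbar)).eventually (hlsc xbar (φ xbar - (ε : EReal)) (by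
        change φ xbar - (ε : EReal) < φ xbar
        rw [ha, ← EReal.coe_sub, EReal.coe_lt_coe_iff]; linarith))
    filter_upwards [e1, e2, e3, e4] with p h1 h2 h3 h4
    refine ⟨fun hp => (tomem _ _ h1 h2 hp.2.2.2.2 hp.1).1, fun hp => ?_⟩
    obtain ⟨hp1, hp2⟩ := frommem _ _ h1 h2 hp
    refine ⟨hp1, h2, h1, h4, ?_⟩
    have h5 := subgradient_inequality_of_convex hψbot hψconv hp xbar
    obtain ⟨b, hb⟩ := (EReal.eq_top_or_exists_coe (hψbot p.1)).resolve_left hp.1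
    rw [← hbar, hb, ha] at h5
    rw [hp2, hb, ha]
    norm_cast at h5 ⊢
    linarith

/-- Under subdifferential continuity, the attentive localization agrees locally with the
subdifferential. -/
theorem IsSubdifferentiallyContinuousAt.attentiveLocalization_germ {φ : E → EReal}
    (hbot : ∀ u, φ u ≠ ⊥) {xbar vbar : E} (h : IsSubdifferentiallyContinuousAt φ xbar vbar)
    {ε : ℝ} (hε : 0 < ε) :
    ∀ᶠ p in 𝓝 (xbar, vbar), p.2 ∈ attentiveLocalization φ xbar vbar ε p.1 ↔
      p.2 ∈ limitingSubdifferential φ p.1 := by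
  by_contra hcon
  obtain ⟨a, ha⟩ := (EReal.eq_top_or_exists_coe (hbot xbar)).resolve_left h.1.1
  obtain ⟨ps, hps, hps'⟩ := exists_seq_forall_of_frequently (not_eventually.1 hcon)
  -- The localization is contained in `∂φ`, so the germs can differ only at points of the graph of
  -- `∂φ`.
  have hps'' : ∀ k, (ps k).2 ∈ limitingSubdifferential φ (ps k).1 := fun k => by
    by_contra hk
    exact hps' k ⟨fun hk' => absurd hk'.1 hk, fun hk' => absurd hk' hk⟩
  have h1 : Tendsto (fun k => (ps k).1) atTop (𝓝 xbar) := (continuous_fst.tendsto _).comp hps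
  have h2 : Tendsto (fun k => (ps k).2) atTop (𝓝 vbar) := (continuous_snd.tendsto _).comp hps
  have h3 := h.2 _ _ h1 h2 hps''
  have e1 := h1.eventually (Metric.ball_mem_nhds xbar hε)
  have e2 := h2.eventually (Metric.ball_mem_nhds vbar hε)
  have e3 := h3.eventually (lt_mem_nhds (show φ xbar - (ε : EReal) < φ xbar by
    rw [ha, ← EReal.coe_sub, EReal.coe_lt_coe_iff]; linarith))
  have e4 := h3.eventually (gt_mem_nhds (show φ xbar < φ xbar + (ε : EReal) by
    rw [ha, ← EReal.coe_add, EReal.coe_lt_coe_iff]; linarith))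
  obtain ⟨k, hk1, hk2, hk3, hk4⟩ := (e1.and (e2.and (e3.and e4))).exists
  have hk1' : ‖(ps k).1 - xbar‖ < ε := by rwa [← dist_eq_norm]
  have hk2' : ‖(ps k).2 - vbar‖ < ε := by rwa [← dist_eq_norm]
  exact hps' k ⟨fun _ => hps'' k, fun _ => ⟨hps'' k, hk2', hk1', hk3, hk4⟩⟩

end Convexity

/-! ### From positive semidefinite coderivatives to variational convexity. -/

section Monotonicity

variable {E : Type*} [NormedAddCommGroup E] [InnerProductSpace ℝ E]

/-- Prox-regularity makes the resolvent of the attentive localization Lipschitz. -/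
theorem ProxRegularInequality.norm_sub_le {φ : E → EReal} (hbot : ∀ u, φ u ≠ ⊥) {xbar vbar : E}
    {ε r lam : ℝ} (h : ProxRegularInequality φ xbar vbar ε r) (hlam : 0 < lam)
    (hlr : lam * r ≤ 1 / 2) {u₁ v₁ u₂ v₂ : E}
    (h₁ : v₁ ∈ attentiveLocalization φ xbar vbar ε u₁)
    (h₂ : v₂ ∈ attentiveLocalization φ xbar vbar ε u₂) :
    ‖u₁ - u₂‖ ≤ 2 * ‖(u₁ + lam • v₁) - (u₂ + lam • v₂)‖ := by
  -- Adding the two prox-regular inequalities gives monotonicity up to `-r‖u₁ - u₂‖²`; `lam * r ≤ 1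
  -- / 2` leaves half of the square coming from the identity.
  have e1 := h u₂ u₁ v₁ h₂.2.2.1 h₁.2.2.1 h₁.2.1 h₁.2.2.2.2 h₁.1
  have e2 := h u₁ u₂ v₂ h₁.2.2.1 h₂.2.2.1 h₂.2.1 h₂.2.2.2.2 h₂.1
  obtain ⟨a, ha⟩ := (EReal.eq_top_or_exists_coe (hbot u₁)).resolve_left h₁.1.1
  obtain ⟨b, hb⟩ := (EReal.eq_top_or_exists_coe (hbot u₂)).resolve_left h₂.1.1
  rw [ha, hb] at e1 e2
  norm_cast at e1 e2
  rw [← neg_sub u₁ u₂, inner_neg_right, norm_neg] at e1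
  set c := (u₁ + lam • v₁) - (u₂ + lam • v₂) with hc
  have hc' : c = (u₁ - u₂) + lam • (v₁ - v₂) := by rw [hc]; module
  have h3 : inner ℝ c (u₁ - u₂) = ‖u₁ - u₂‖ ^ 2 + lam * (inner ℝ v₁ (u₁ - u₂) -
      inner ℝ v₂ (u₁ - u₂)) := by
    rw [hc', inner_add_left, real_inner_smul_left, real_inner_self_eq_norm_sq,
      inner_sub_left v₁ v₂]
  have h4 := real_inner_le_norm c (u₁ - u₂)
  have h5 : lam * (inner ℝ v₁ (u₁ - u₂) - inner ℝ v₂ (u₁ - u₂)) ≥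
      lam * (-r * ‖u₁ - u₂‖ ^ 2) := by gcongr; linarith
  have h6 : lam * r * ‖u₁ - u₂‖ ^ 2 ≤ 1 / 2 * ‖u₁ - u₂‖ ^ 2 := by gcongr
  by_contra hcon
  push Not at hcon
  have h7 : 0 < ‖u₁ - u₂‖ := lt_of_le_of_lt (by positivity) hcon
  nlinarith

/-- If the resolvent of `T` is locally single-valued and Lipschitz, and the regular coderivatives
of `T` are positive semidefinite, then `T` is locally monotone. -/
theorem inner_sub_nonneg_of_regularCoderivative_posSemidef [ProperSpace E] {T : E → Set E}
    {lam δ : ℝ} (hlam : 0 < lam) (hδ : 0 < δ) {c : E} {P V : E → E}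
    (hPV : ∀ s ∈ Metric.ball c δ, P s + lam • V s = s)
    (hmem : ∀ s ∈ Metric.ball c δ, V s ∈ T (P s))
    (hlip : ∀ u₁ v₁ u₂ v₂, v₁ ∈ T u₁ → v₂ ∈ T u₂ →
      ‖u₁ - u₂‖ ≤ 2 * ‖(u₁ + lam • v₁) - (u₂ + lam • v₂)‖)
    (hpsd : ∀ s ∈ Metric.ball c δ, ∀ w, ∀ z ∈ regularCoderivative T (P s) (V s) w,
      0 ≤ inner ℝ z w) {s₁ s₂ : E} (hs₁ : s₁ ∈ Metric.ball c (δ / 2))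
    (hs₂ : s₂ ∈ Metric.ball c (δ / 2)) : 0 ≤ inner ℝ (V s₁ - V s₂) (P s₁ - P s₂) := by
  have hPlip : ∀ s ∈ Metric.ball c δ, ∀ t ∈ Metric.ball c δ, ‖P s - P t‖ ≤ 2 * ‖s - t‖ := by
    intro s hs t ht
    have := hlip _ _ _ _ (hmem s hs) (hmem t ht)
    rwa [hPV s hs, hPV t ht] at this
  -- The reflected resolvent sends `P s + lam • V s` to `P s - lam • V s`.
  set F : E → E := fun s => (2 : ℝ) • P s - s with hF
  have hFlip : ∀ s ∈ Metric.ball c δ, ∀ t ∈ Metric.ball c δ, ‖F s - F t‖ ≤ 5 * ‖s - t‖ := by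
    intro s hs t ht
    have e : F s - F t = (2 : ℝ) • (P s - P t) - (s - t) := by simp only [hF]; module
    rw [e]
    refine (norm_sub_le _ _).trans ?_
    rw [norm_smul, Real.norm_of_nonneg zero_le_two]
    linarith [hPlip s hs t ht]
  have hFexp : ∀ y : E, inner ℝ y (F s₁) ≤ inner ℝ y (F s₂) + ‖y‖ * ‖s₁ - s₂‖ := by
    intro y
    refine le_add_mul_norm_of_proximal_subgradient_le (g := fun s => inner ℝ y (F s))
      (L := 5 * ‖y‖) hδ (norm_nonneg y) ?_ ?_ hs₂ hs₁
    · intro s hs t ht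
      rw [← inner_sub_right]
      refine (abs_real_inner_le_norm _ _).trans ?_
      nlinarith [hFlip s hs t ht, norm_nonneg y]
    · intro s hs ξ C hC
      have hcont : Tendsto (fun p : E × E => p.1 + lam • p.2) (𝓝 (P s, V s)) (𝓝 s) := by
        have := (by fun_prop : Continuous fun p : E × E => p.1 + lam • p.2).tendsto (P s, V s)
        simpa only [hPV s hs] using this
      -- For graph increments `a`, `b`, the proximal inequality reads `⟨ξ, a + λb⟩ ≤ ⟨y, a - λb⟩` up
      -- to a quadratic term; collecting `a` and `b` gives this pair.
      have hz : ξ - y ∈ regularCoderivative T (P s) (V s) (-(lam • (ξ + y))) := by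
        refine mem_regularCoderivative_of_quadratic (hmem s hs) (|C| * (1 + lam) ^ 2) ?_
        filter_upwards [hcont.eventually hC,
          hcont.eventually (Metric.isOpen_ball.mem_nhds hs)] with p hp hpb hpT
        have hPp : p.1 = P (p.1 + lam • p.2) := by
          have := hlip _ _ _ _ hpT (hmem _ hpb)
          rw [hPV _ hpb, sub_self, norm_zero, mul_zero] at this
          exact sub_eq_zero.1 (norm_le_zero_iff.1 this)
        simp only [hF, ← hPp] at hp
        have e1 : p.1 + lam • p.2 - s = (p.1 - P s) + lam • (p.2 - V s) := by
          nth_rewrite 1 [← hPV s hs]; module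
        have e2 : (2 : ℝ) • p.1 - (p.1 + lam • p.2) =
            ((2 : ℝ) • P s - s) + ((p.1 - P s) - lam • (p.2 - V s)) := by
          nth_rewrite 2 [← hPV s hs]; module
        rw [e2, e1, inner_add_right] at hp
        set a := p.1 - P s
        set b := p.2 - V s
        have e3 : ‖a + lam • b‖ ≤ (1 + lam) * (‖a‖ + ‖b‖) := by
          refine (norm_add_le _ _).trans ?_
          rw [norm_smul, Real.norm_of_nonneg hlam.le]
          nlinarith [norm_nonneg a, norm_nonneg b]
        have e4 : C * ‖a + lam • b‖ ^ 2 ≤ |C| * ((1 + lam) * (‖a‖ + ‖b‖)) ^ 2 := by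
          gcongr; exact le_abs_self C
        rw [mul_pow, ← mul_assoc] at e4
        refine le_trans ?_ e4
        simp only [inner_add_right, inner_sub_right, inner_smul_right] at hp
        simp only [inner_neg_left, real_inner_smul_left, inner_add_left, inner_sub_left]
        linarith
      have h0 := hpsd s hs _ _ hz
      rw [inner_neg_right, inner_smul_right] at h0
      have h1 : inner ℝ (ξ - y) (ξ + y) = ‖ξ‖ ^ 2 - ‖y‖ ^ 2 := by
        simp only [inner_sub_left, inner_add_right, real_inner_self_eq_norm_sq,
          real_inner_comm ξ y]; ring
      rw [h1] at h0
      have h2 : ‖ξ‖ ^ 2 ≤ ‖y‖ ^ 2 := by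
        by_contra hcon
        push Not at hcon
        nlinarith
      exact abs_le_of_sq_le_sq' h2 (norm_nonneg y) |>.2
  have hne : ‖F s₁ - F s₂‖ ≤ ‖s₁ - s₂‖ := by
    -- Testing with `y` equal to the difference itself turns the scalar bounds into
    -- nonexpansiveness.
    have h1 := hFexp (F s₁ - F s₂)
    have h2 : inner ℝ (F s₁ - F s₂) (F s₁ - F s₂) ≤ ‖F s₁ - F s₂‖ * ‖s₁ - s₂‖ := by
      rw [inner_sub_right]; linarith
    rw [real_inner_self_eq_norm_sq] at h2
    by_contra hcon
    push Not at hcon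
    nlinarith [norm_nonneg (s₁ - s₂)]
  have hsub : Metric.ball c (δ / 2) ⊆ Metric.ball c δ := Metric.ball_subset_ball (by linarith)
  have e1 : s₁ - s₂ = (P s₁ - P s₂) + lam • (V s₁ - V s₂) := by
    nth_rewrite 1 [← hPV s₁ (hsub hs₁), ← hPV s₂ (hsub hs₂)]; module
  have e2 : F s₁ - F s₂ = (P s₁ - P s₂) - lam • (V s₁ - V s₂) := by
    simp only [hF]
    linear_combination (norm := module) hPV s₁ (hsub hs₁) - hPV s₂ (hsub hs₂)
  rw [e1, e2] at hne
  have h0 := inner_nonneg_of_norm_sub_le_norm_add hne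
  rw [inner_smul_right, real_inner_comm] at h0
  exact nonneg_of_mul_nonneg_right h0 hlam

/-- If the proximal mapping of `φ` has a local selection whose associated subgradients are
monotone, then these subgradients satisfy the convex subgradient inequality locally. -/
theorem subgradient_inequality_of_monotone_resolvent {φ : E → EReal} (hbot : ∀ u, φ u ≠ ⊥)
    {lam δ ρ : ℝ} (hlam : 0 < lam) {c x₀ : E} {P V : E → E}
    (hPV : ∀ s ∈ Metric.ball c δ, P s + lam • V s = s)
    (hfin : ∀ s ∈ Metric.ball c δ, φ (P s) ≠ ⊤)
    (hP : ∀ s ∈ Metric.ball c δ, ‖P s - x₀‖ < ρ)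
    (hopt : ∀ s ∈ Metric.ball c δ, ∀ y, ‖y - x₀‖ < ρ →
      φ (P s) + ((lam / 2 * ‖V s‖ ^ 2 : ℝ) : EReal) ≤
        φ y + (((2 * lam)⁻¹ * ‖y - s‖ ^ 2 : ℝ) : EReal))
    (hmono : ∀ s ∈ Metric.ball c δ, ∀ t ∈ Metric.ball c δ,
      0 ≤ inner ℝ (V s - V t) (P s - P t))
    {s x : E} (hs : s ∈ Metric.ball c δ) (hx : ‖x - x₀‖ < ρ)
    (hxs : x + lam • V s ∈ Metric.ball c δ) :
    φ (P s) + ((inner ℝ (V s) (x - P s) : ℝ) : EReal) ≤ φ x := by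
  -- The Moreau envelope of `φ` along the resolvent, with `V` as its gradient candidate.
  set e : E → ℝ := fun s => (φ (P s)).toReal + lam / 2 * ‖V s‖ ^ 2 with he
  have hcoe : ∀ s ∈ Metric.ball c δ, ((φ (P s)).toReal : EReal) = φ (P s) := fun s hs =>
    EReal.coe_toReal (hfin s hs) (hbot _)
  have hstep : ∀ s ∈ Metric.ball c δ, ∀ t ∈ Metric.ball c δ,
      e s + inner ℝ (V t) (t - s) - (2 * lam)⁻¹ * ‖t - s‖ ^ 2 ≤ e t := by
    intro s hs t ht
    have h1 := hopt s hs (P t) (hP t ht)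
    rw [← hcoe s hs, ← hcoe t ht] at h1
    norm_cast at h1
    have h2 : P t - s = (t - s) - lam • V t := by
      nth_rewrite 2 [← hPV t ht]; module
    rw [h2, norm_sub_sq_real, inner_smul_right, norm_smul, Real.norm_of_nonneg hlam.le,
      real_inner_comm] at h1
    have h3 : (2 * lam)⁻¹ * (‖t - s‖ ^ 2 - 2 * (lam * inner ℝ (V t) (t - s)) +
        (lam * ‖V t‖) ^ 2) = (2 * lam)⁻¹ * ‖t - s‖ ^ 2 - inner ℝ (V t) (t - s) +
        lam / 2 * ‖V t‖ ^ 2 := by field_simp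
    simp only [he]
    linarith
  have hVmono : ∀ s ∈ Metric.ball c δ, ∀ t ∈ Metric.ball c δ,
      0 ≤ inner ℝ (V t - V s) (t - s) := by
    intro s hs t ht
    have h1 : t - s = (P t - P s) + lam • (V t - V s) := by
      nth_rewrite 1 [← hPV t ht, ← hPV s hs]; module
    rw [h1, inner_add_right, inner_smul_right, real_inner_self_eq_norm_sq]
    have := hmono t ht s hs
    positivity
  set y := x + lam • V s with hy
  have hseg : ∀ t : ℝ, 0 ≤ t → t ≤ 1 → s + t • (y - s) ∈ Metric.ball c δ :=
    fun t h0 h1 => (convex_ball c δ).add_smul_sub_mem hs hxs ⟨h0, h1⟩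
  -- Monotonicity replaces `V` along the segment by `V s`, and subdivision removes the quadratic
  -- error of `hstep`.
  have hconv : e s + inner ℝ (V s) (y - s) ≤ e y := by
    have := le_of_forall_sub_mul_sq_le
      (f := fun t => e (s + t • (y - s)) - t * inner ℝ (V s) (y - s))
      (M := (2 * lam)⁻¹ * ‖y - s‖ ^ 2) (by
        intro t₁ t₂ h0 h12 h1
        have k1 := hstep _ (hseg t₁ h0 (h12.trans h1)) _ (hseg t₂ (h0.trans h12) h1)
        have k2 := hVmono _ hs _ (hseg t₂ (h0.trans h12) h1)
        have k3 : s + t₂ • (y - s) - (s + t₁ • (y - s)) = (t₂ - t₁) • (y - s) := by module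
        rw [k3, inner_smul_right, norm_smul, Real.norm_of_nonneg (by linarith)] at k1
        rw [add_sub_cancel_left, inner_smul_right] at k2
        have k4 : (t₂ - t₁) * inner ℝ (V s) (y - s) ≤
            (t₂ - t₁) * inner ℝ (V (s + t₂ • (y - s))) (y - s) := by
          rcases h12.eq_or_lt with heq | hlt
          · rw [heq]; simp
          · have ht2 : 0 < t₂ := lt_of_le_of_lt h0 hlt
            have k5 := nonneg_of_mul_nonneg_right k2 ht2
            rw [inner_sub_left] at k5
            exact mul_le_mul_of_nonneg_left (by linarith) (by linarith)
        have k6 : (2 * lam)⁻¹ * ‖y - s‖ ^ 2 * (t₂ - t₁) ^ 2 =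
          (2 * lam)⁻¹ * ((t₂ - t₁) * ‖y - s‖) ^ 2 := by ring
        rw [k6]
        linarith)
    simp only [zero_smul, add_zero, zero_mul, sub_zero, one_smul, one_mul,
      add_sub_cancel] at this
    linarith
  -- Since `y = x + lam • V s`, taking `x` as competitor costs `lam / 2 * ‖V s‖²`, which cancels the
  -- same term in `e s`.
  have h1 := hopt y hxs x hx
  rcases EReal.eq_top_or_exists_coe (hbot x) with ht | ⟨b, hb⟩
  · rw [ht]; exact le_top
  rw [hb, ← hcoe y hxs] at h1
  rw [hb, ← hcoe s hs]
  norm_cast at h1 ⊢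
  have h2 : x - y = -(lam • V s) := by rw [hy]; abel
  rw [h2, norm_neg, norm_smul, Real.norm_of_nonneg hlam.le] at h1
  have h3 : (2 * lam)⁻¹ * (lam * ‖V s‖) ^ 2 = lam / 2 * ‖V s‖ ^ 2 := by field_simp
  have h4 : y - s = x - P s := by
    rw [hy]; nth_rewrite 2 [← hPV s hs]; abel
  simp only [he, h4] at hconv
  linarith

theorem isConvexEReal_iSup_affine {ι : Type*} (α : ι → ℝ) (v p : ι → E) :
    IsConvexEReal fun x => ⨆ i, ((α i + inner ℝ (v i) (x - p i) : ℝ) : EReal) := by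
  intro q hq q' hq' a b ha hb hab
  simp only [Set.mem_ofPred_eq, iSup_le_iff, EReal.coe_le_coe_iff] at hq hq' ⊢
  intro i
  have h1 := mul_le_mul_of_nonneg_left (hq i) ha
  have h2 := mul_le_mul_of_nonneg_left (hq' i) hb
  have h3 : (a • q + b • q').1 - p i = a • (q.1 - p i) + b • (q'.1 - p i) := by
    have : p i = (a + b) • p i := by rw [hab, one_smul]
    nth_rewrite 1 [this]
    simp only [Prod.fst_add, Prod.smul_fst]; module
  have h4 : α i = a * α i + b * α i := by rw [← add_mul, hab, one_mul]
  rw [h3, inner_add_right, inner_smul_right, inner_smul_right]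
  simp only [Prod.snd_add, Prod.smul_snd, smul_eq_mul]
  nth_rewrite 1 [h4]
  linarith

theorem lowerSemicontinuous_iSup_affine {ι : Type*} (α : ι → ℝ) (v p : ι → E) :
    LowerSemicontinuous fun x => ⨆ i, ((α i + inner ℝ (v i) (x - p i) : ℝ) : EReal) :=
  lowerSemicontinuous_iSup fun _ =>
    (continuous_coe_real_ereal.comp (by fun_prop)).lowerSemicontinuous

/-- Prox-regularity and positive semidefiniteness of the regular coderivatives of the attentive
localization imply variational convexity. -/
theorem isVariationallyConvexAt_of_regularCoderivative_posSemidef [ProperSpace E]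
    {φ : E → EReal} (hbot : ∀ u, φ u ≠ ⊥) (hlsc : LowerSemicontinuous φ) {xbar vbar : E}
    (hv : vbar ∈ limitingSubdifferential φ xbar) {ε r : ℝ} (hε : 0 < ε) (hr : 0 ≤ r)
    (hpr : ProxRegularInequality φ xbar vbar ε r) {W : Set (E × E)} (hW : W ∈ 𝓝 (xbar, vbar))
    (hpsd : ∀ u v, (u, v) ∈ svGraph (attentiveLocalization φ xbar vbar ε) ∩ W →
      ∀ w, ∀ z ∈ regularCoderivative (attentiveLocalization φ xbar vbar ε) u v w,
        0 ≤ inner ℝ z w) : IsVariationallyConvexAt φ xbar vbar := by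
  obtain ⟨a₀, ha₀⟩ := (EReal.eq_top_or_exists_coe (hbot xbar)).resolve_left hv.1
  set T := attentiveLocalization φ xbar vbar ε with hT
  -- The `+ 1` keeps the step size defined when `r = 0`.
  set lam : ℝ := (2 * (r + 1))⁻¹ with hlamdef
  have hlam : 0 < lam := by positivity
  have hlr : lam * r ≤ 1 / 2 := by
    rw [hlamdef, inv_mul_le_iff₀ (by positivity)]; linarith
  set sbar := xbar + lam • vbar with hsbar
  have hbarT : vbar ∈ T xbar := by
    refine ⟨hv, by simpa, by simpa, ?_, ?_⟩
    · rw [ha₀, ← EReal.coe_sub, EReal.coe_lt_coe_iff]; linarith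
    · rw [ha₀, ← EReal.coe_add, EReal.coe_lt_coe_iff]; linarith
  have hlip : ∀ u₁ v₁ u₂ v₂, v₁ ∈ T u₁ → v₂ ∈ T u₂ →
      ‖u₁ - u₂‖ ≤ 2 * ‖(u₁ + lam • v₁) - (u₂ + lam • v₂)‖ := fun _ _ _ _ h₁ h₂ =>
    hpr.norm_sub_le hbot hlam hlr h₁ h₂
  have hq : ∀ x, ‖x - xbar‖ < ε →
      φ xbar + ((inner ℝ vbar (x - xbar) - r / 2 * ‖x - xbar‖ ^ 2 : ℝ) : EReal) ≤ φ x :=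
    fun x hx => hpr x xbar vbar hx (by simpa) (by simpa) hbarT.2.2.2.2 hv
  have hres := fun (η : ℝ) (hη : 0 < η) =>
    exists_local_resolvent hbot hlsc hv.1 hε hr hlam hlr hq hη
  have toT : ∀ η ≤ ε, ∀ x v, ‖x - xbar‖ < η → ‖v - vbar‖ < η →
      v ∈ regularSubdifferential φ x → φ xbar - (η : EReal) < φ x →
      φ x < φ xbar + (η : EReal) → v ∈ T x := fun η hη x v h1 h2 h3 h4 h5 =>
    ⟨regularSubdifferential_subset_limitingSubdifferential h3, h2.trans_le hη, h1.trans_le hη,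
      lt_of_le_of_lt (EReal.sub_le_sub le_rfl (by exact_mod_cast hη)) h4,
      h5.trans_le (add_le_add le_rfl (by exact_mod_cast hη))⟩
  obtain ⟨κ, hκ, hκW⟩ := Metric.mem_nhds_iff.1 hW
  set η₀ := min (ε / 2) κ with hη₀
  have hη₀pos : 0 < η₀ := lt_min (by positivity) hκ
  have hη₀ε : η₀ ≤ ε / 2 := min_le_left _ _
  obtain ⟨δ, hδ, hδ'⟩ := hres η₀ hη₀pos
  choose! P V hPV hPx hVv hreg hφl hφu hopt using hδ'
  have hball : ∀ {s : E} {ρ : ℝ}, s ∈ Metric.ball sbar ρ ↔ ‖s - sbar‖ < ρ := by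
    intro s ρ; rw [Metric.mem_ball, dist_eq_norm]
  have hPVT : ∀ s, ‖s - sbar‖ < δ → V s ∈ T (P s) := fun s hs =>
    toT η₀ (by linarith) _ _ (hPx s hs) (hVv s hs) (hreg s hs) (hφl s hs) (hφu s hs)
  have huniq : ∀ s, ‖s - sbar‖ < δ → ∀ u v, v ∈ T u → u + lam • v = s → u = P s ∧ v = V s := by
    intro s hs u v huv hsum
    have h1 := hlip _ _ _ _ huv (hPVT s hs)
    rw [hsum, hPV s hs, sub_self, norm_zero, mul_zero] at h1
    have h2 : u = P s := sub_eq_zero.1 (norm_le_zero_iff.1 h1)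
    refine ⟨h2, ?_⟩
    have h3 : lam • v = lam • V s := by
      have h4 := hsum.trans (hPV s hs).symm
      rwa [h2, add_right_inj] at h4
    exact smul_right_injective E hlam.ne' h3
  have hmono : ∀ s ∈ Metric.ball sbar (δ / 2), ∀ t ∈ Metric.ball sbar (δ / 2),
      0 ≤ inner ℝ (V s - V t) (P s - P t) := fun s hs t ht =>
    inner_sub_nonneg_of_regularCoderivative_posSemidef hlam hδ
      (fun s hs => hPV s (hball.1 hs)) (fun s hs => hPVT s (hball.1 hs)) hlip
      (fun s hs => hpsd _ _ ⟨hPVT s (hball.1 hs), hκW (by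
        rw [Metric.mem_ball, Prod.dist_eq, dist_eq_norm, dist_eq_norm]
        exact max_lt ((hPx s (hball.1 hs)).trans_le (min_le_right _ _))
          ((hVv s (hball.1 hs)).trans_le (min_le_right _ _)))⟩) hs ht
  have hhalf : ∀ s ∈ Metric.ball sbar (δ / 2), ‖s - sbar‖ < δ := fun s hs => by
    have := hball.1 hs; linarith
  have hineq : ∀ s ∈ Metric.ball sbar (δ / 2), ∀ x, ‖x - xbar‖ < ε / 2 →
      x + lam • V s ∈ Metric.ball sbar (δ / 2) →
      φ (P s) + ((inner ℝ (V s) (x - P s) : ℝ) : EReal) ≤ φ x := fun s hs x hx hxs =>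
    subgradient_inequality_of_monotone_resolvent hbot hlam (fun s hs => hPV s (hhalf s hs))
      (fun s hs => (hPVT s (hhalf s hs)).1.1)
      (fun s hs => (hPx s (hhalf s hs)).trans_le hη₀ε) (fun s hs => hopt s (hhalf s hs))
      hmono hs hx hxs
  obtain ⟨κ', hκ', hκ'φ⟩ := Metric.eventually_nhds_iff.1 (hlsc xbar (φ xbar - (ε : EReal))
    hbarT.2.2.2.1)
  -- Keeps `x + lam • V s` in the half ball where `hineq` applies, and `φ` above `φ xbar - ε`.
  set η₁ := min (min κ' (ε / 2)) (δ / 2 / (1 + lam)) with hη₁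
  have hη₁pos : 0 < η₁ := lt_min (lt_min hκ' (by positivity)) (by positivity)
  have hη₁κ : η₁ ≤ κ' := (min_le_left _ _).trans (min_le_left _ _)
  have hη₁ε : η₁ ≤ ε / 2 := (min_le_left _ _).trans (min_le_right _ _)
  have hη₁δ : η₁ * (1 + lam) ≤ δ / 2 := by
    rw [← le_div_iff₀ (by positivity)]; exact min_le_right _ _
  have hsum : ∀ {η ρ : ℝ}, η * (1 + lam) ≤ ρ → ∀ x v, ‖x - xbar‖ < η → ‖v - vbar‖ < η →
      x + lam • v ∈ Metric.ball sbar ρ := by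
    intro η ρ hηρ x v hx hv
    rw [hball]
    have e : x + lam • v - sbar = (x - xbar) + lam • (v - vbar) := by rw [hsbar]; module
    rw [e]
    refine lt_of_le_of_lt (norm_add_le _ _) ?_
    rw [norm_smul, Real.norm_of_nonneg hlam.le]
    nlinarith
  obtain ⟨δ', hδ'pos, hδ'⟩ := hres η₁ hη₁pos
  set δ₁ := min δ' (δ / 2) with hδ₁
  have hδ₁pos : 0 < δ₁ := lt_min hδ'pos (by positivity)
  have hδ₁half : ∀ s ∈ Metric.ball sbar δ₁, s ∈ Metric.ball sbar (δ / 2) := fun s hs =>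
    Metric.ball_subset_ball (min_le_right _ _) hs
  have hnear : ∀ s ∈ Metric.ball sbar δ₁, ‖P s - xbar‖ < η₁ ∧ ‖V s - vbar‖ < η₁ := by
    intro s hs
    -- The finer radius gives a possibly different resolvent pair; `huniq` identifies it with `P s`,
    -- `V s`.
    obtain ⟨x, v, h1, h2, h3, h4, h5, h6, -⟩ :=
      hδ' s ((hball.1 hs).trans_le (min_le_left _ _))
    obtain ⟨rfl, rfl⟩ := huniq s (hhalf s (hδ₁half s hs)) x v
      (toT η₁ (by linarith) x v h2 h3 h4 h5 h6) h1
    exact ⟨h2, h3⟩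
  -- The supremum of the affine minorants supplied by `hineq`; it touches `φ` at each `P s`.
  set ψ : E → EReal := fun x => ⨆ s : Metric.ball sbar δ₁,
    (((φ (P s)).toReal + inner ℝ (V s) (x - P s) : ℝ) : EReal) with hψ
  have hcoe : ∀ s ∈ Metric.ball sbar δ₁, ((φ (P s)).toReal : EReal) = φ (P s) := fun s hs =>
    EReal.coe_toReal (hPVT s (hhalf s (hδ₁half s hs))).1.1 (hbot _)
  have hψge : ∀ s ∈ Metric.ball sbar δ₁, ∀ x,
      φ (P s) + ((inner ℝ (V s) (x - P s) : ℝ) : EReal) ≤ ψ x := by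
    intro s hs x
    rw [← hcoe s hs, ← EReal.coe_add]
    exact le_iSup (fun s : Metric.ball sbar δ₁ =>
      (((φ (P s)).toReal + inner ℝ (V s) (x - P s) : ℝ) : EReal)) ⟨s, hs⟩
  have hψle : ∀ x, ‖x - xbar‖ < η₁ → ψ x ≤ φ x := by
    intro x hx
    refine iSup_le fun ⟨s, hs⟩ => ?_
    simp only
    rw [EReal.coe_add, hcoe s hs]
    exact hineq s (hδ₁half s hs) x (hx.trans_le hη₁ε) (hsum hη₁δ x (V s) hx (hnear s hs).2)
  have hψbot : ∀ x, ψ x ≠ ⊥ := by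
    intro x hx
    have hs : sbar ∈ Metric.ball sbar δ₁ := Metric.mem_ball_self hδ₁pos
    have h1 := hψge sbar hs x
    rw [hx, ← hcoe sbar hs, ← EReal.coe_add] at h1
    exact absurd h1 (not_le.2 (EReal.bot_lt_coe _))
  have hψlsc : LowerSemicontinuous ψ := lowerSemicontinuous_iSup_affine _ _ _
  have hψconv : IsConvexEReal ψ := isConvexEReal_iSup_affine _ _ _
  have hψeq : ∀ s ∈ Metric.ball sbar δ₁, ψ (P s) = φ (P s) := fun s hs =>
    le_antisymm (hψle _ (hnear s hs).1) (by simpa using hψge s hs (P s))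
  have hψsub : ∀ s ∈ Metric.ball sbar δ₁, V s ∈ limitingSubdifferential ψ (P s) := by
    intro s hs
    refine mem_limitingSubdifferential_of_inequality hψbot ?_ fun y => ?_
    · rw [hψeq s hs]; exact (hPVT s (hhalf s (hδ₁half s hs))).1.1
    · rw [hψeq s hs]; exact hψge s hs y
  set η₂ := min η₁ (δ₁ / (1 + lam)) with hη₂
  have hη₂pos : 0 < η₂ := lt_min hη₁pos (by positivity)
  have hη₂η₁ : η₂ ≤ η₁ := min_le_left _ _
  have hη₂δ : η₂ * (1 + lam) ≤ δ₁ := by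
    rw [← le_div_iff₀ (by positivity)]; exact min_le_right _ _
  have hconverse : ∀ x v, ‖x - xbar‖ < η₂ → ‖v - vbar‖ < η₂ → v ∈ limitingSubdifferential ψ x →
      x = P (x + lam • v) ∧ v = V (x + lam • v) := by
    intro x v hx hv hvx
    have hs := hsum hη₂δ x v hx hv
    set s := x + lam • v with hsdef
    -- Both `(x, v)` and `(P s, V s)` lie in the graph of `∂ψ` and have the same sum `s`, so
    -- monotonicity forces them to coincide.
    have h1 := subdifferential_monotone_of_convex hψbot hψconv hvx (hψsub s hs)
    have h2 : x - P s = -(lam • (v - V s)) := by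
      have h3 : x + lam • v = P s + lam • V s := (hPV s (hhalf s (hδ₁half s hs))).symm
      rw [smul_sub, neg_sub, sub_eq_sub_iff_add_eq_add, h3, add_comm]
    rw [h2, inner_neg_right, inner_smul_right, real_inner_self_eq_norm_sq] at h1
    have h4 : ‖v - V s‖ ^ 2 ≤ 0 := by
      by_contra hcon
      push Not at hcon
      nlinarith
    have h5 : v = V s := sub_eq_zero.1 (norm_eq_zero.1 (pow_eq_zero_iff two_ne_zero |>.1
      (le_antisymm h4 (sq_nonneg _))))
    refine ⟨?_, h5⟩
    rw [← h5, sub_self, smul_zero, neg_zero] at h2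
    exact sub_eq_zero.1 h2
  refine ⟨Metric.ball xbar η₂, Metric.ball_mem_nhds _ hη₂pos, convex_ball _ _,
    Metric.ball vbar η₂, Metric.ball_mem_nhds _ hη₂pos, convex_ball _ _, ψ, hψbot, hψlsc, hψconv,
    fun x hx => hψle x (by rw [← dist_eq_norm]; exact (Metric.mem_ball.1 hx).trans_le hη₂η₁),
    ε, hε, ?_, ?_⟩
  · ext ⟨x, v⟩
    constructor
    · rintro ⟨⟨⟨hx, hφx⟩, hvV⟩, hvx⟩
      refine ⟨⟨hx, hvV⟩, ?_⟩
      have hx' : ‖x - xbar‖ < η₂ := by rw [← dist_eq_norm]; exact hx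
      have hv' : ‖v - vbar‖ < η₂ := by rw [← dist_eq_norm]; exact hvV
      have hs := hsum hη₂δ x v hx' hv'
      obtain ⟨h1, h2⟩ := huniq _ (hhalf _ (hδ₁half _ hs)) x v
        ⟨hvx, by linarith, by linarith, hκ'φ ((Metric.mem_ball.1 hx).trans_le
          (hη₂η₁.trans hη₁κ)), hφx⟩ rfl
      have h3 := hψsub _ hs
      rwa [← h1, ← h2] at h3
    · rintro ⟨⟨hx, hvV⟩, hvx⟩
      have hx' : ‖x - xbar‖ < η₂ := by rw [← dist_eq_norm]; exact hx
      have hv' : ‖v - vbar‖ < η₂ := by rw [← dist_eq_norm]; exact hvV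
      have hs := hsum hη₂δ x v hx' hv'
      obtain ⟨h1, h2⟩ := hconverse x v hx' hv' hvx
      have h3 := hPVT _ (hhalf _ (hδ₁half _ hs))
      rw [← h1, ← h2] at h3
      exact ⟨⟨⟨hx, h3.2.2.2.2⟩, hvV⟩, h3.1⟩
  · rintro ⟨x, v⟩ ⟨⟨hx, hvV⟩, hvx⟩
    have hx' : ‖x - xbar‖ < η₂ := by rw [← dist_eq_norm]; exact hx
    have hv' : ‖v - vbar‖ < η₂ := by rw [← dist_eq_norm]; exact hvV
    have hs := hsum hη₂δ x v hx' hv'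
    have h3 := hψeq _ hs
    rw [← (hconverse x v hx' hv' hvx).1] at h3
    exact h3.symm

end Monotonicity

/-! ### The equivalences. -/

theorem theorem5p4 (n : ℕ) (φ : EuclideanSpace ℝ (Fin n) → EReal)
    (hbot : ∀ x, φ x ≠ ⊥) (hlsc : LowerSemicontinuous φ)
    (xbar vbar : EuclideanSpace ℝ (Fin n))
    (hx : φ xbar ≠ ⊤) (hv : vbar ∈ limitingSubdifferential φ xbar) :
    List.TFAE [
      IsVariationallyConvexAt φ xbar vbar,
      IsProxRegularAt φ xbar vbar ∧
        ∃ ε : ℝ, 0 < ε ∧ (∃ r : ℝ, 0 ≤ r ∧ ProxRegularInequality φ xbar vbar ε r) ∧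
          ∃ W ∈ 𝓝 (xbar, vbar),
            ∀ u v, (u, v) ∈ svGraph (attentiveLocalization φ xbar vbar ε) ∩ W →
              ∀ w, ∀ z ∈ limitingCoderivative (attentiveLocalization φ xbar vbar ε) u v w,
                0 ≤ inner ℝ z w,
      IsProxRegularAt φ xbar vbar ∧
        ∃ ε : ℝ, 0 < ε ∧ (∃ r : ℝ, 0 ≤ r ∧ ProxRegularInequality φ xbar vbar ε r) ∧
          ∃ W ∈ 𝓝 (xbar, vbar),
            ∀ u v, (u, v) ∈ svGraph (attentiveLocalization φ xbar vbar ε) ∩ W →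
              ∀ w, ∀ z ∈ regularCoderivative (attentiveLocalization φ xbar vbar ε) u v w,
                0 ≤ inner ℝ z w] ∧
    (IsSubdifferentiallyContinuousAt φ xbar vbar →
      List.TFAE [
        IsVariationallyConvexAt φ xbar vbar,
        IsProxRegularAt φ xbar vbar ∧
          ∃ ε : ℝ, 0 < ε ∧ ∃ W ∈ 𝓝 (xbar, vbar),
            ∀ u v, (u, v) ∈ svGraph (attentiveLocalization φ xbar vbar ε) ∩ W →
              ∀ w, ∀ z ∈ limitingSecondSubdifferential φ u v w, 0 ≤ inner ℝ z w,
        IsProxRegularAt φ xbar vbar ∧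
          ∃ ε : ℝ, 0 < ε ∧ ∃ W ∈ 𝓝 (xbar, vbar),
            ∀ u v, (u, v) ∈ svGraph (attentiveLocalization φ xbar vbar ε) ∩ W →
              ∀ w, ∀ z ∈ combinedSecondSubdifferential φ u v w, 0 ≤ inner ℝ z w]) := by
  have hprox : ∀ {ε r : ℝ}, 0 < ε → 0 ≤ r → ProxRegularInequality φ xbar vbar ε r →
      IsProxRegularAt φ xbar vbar := fun hε hr h =>
    ⟨hv, hx, hbot _, Eventually.of_forall fun x => hlsc x, _, hε, _, hr, h⟩
  refine ⟨?_, fun hsc => ?_⟩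
  · tfae_have 1 → 2 := fun h => by
      obtain ⟨ψ, hψbot, hψlsc, hψconv, ε, hε, hpr, hgerm⟩ := h.exists_convex_germ hbot hlsc hv
      obtain ⟨W, hW, hpsd⟩ := limitingCoderivative_posSemidef_of_germ hψbot hψlsc hψconv hgerm
      exact ⟨hprox hε le_rfl hpr, ε, hε, ⟨0, le_rfl, hpr⟩, W, hW,
        fun u v huv => hpsd u v huv.2⟩
    tfae_have 2 → 3 := fun ⟨h, ε, hε, hr, W, hW, hpsd⟩ =>
      ⟨h, ε, hε, hr, W, hW, fun u v huv w z hz =>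
        hpsd u v huv w z (regularCoderivative_subset_limitingCoderivative hz)⟩
    tfae_have 3 → 1 := fun ⟨_, ε, hε, ⟨r, hr, hpr⟩, W, hW, hpsd⟩ =>
      isVariationallyConvexAt_of_regularCoderivative_posSemidef hbot hlsc hv hε hr hpr hW hpsd
    tfae_finish
  · tfae_have 1 → 2 := fun h => by
      obtain ⟨ψ, hψbot, hψlsc, hψconv, ε, hε, hpr, hgerm⟩ := h.exists_convex_germ hbot hlsc hv
      obtain ⟨W, hW, hpsd⟩ := limitingCoderivative_posSemidef_of_germ
        (F := limitingSubdifferential φ) hψbot hψlsc hψconv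
        (by filter_upwards [hgerm, hsc.attentiveLocalization_germ hbot hε] with p h1 h2
            exact h2.symm.trans h1)
      exact ⟨hprox hε le_rfl hpr, ε, hε, W, hW, fun u v huv => hpsd u v huv.2⟩
    tfae_have 2 → 3 := fun ⟨h, ε, hε, W, hW, hpsd⟩ =>
      ⟨h, ε, hε, W, hW, fun u v huv w z hz =>
        hpsd u v huv w z (regularCoderivative_subset_limitingCoderivative hz)⟩
    tfae_have 3 → 1 := fun ⟨⟨_, _, _, _, ε', hε', r, hr, hpr⟩, ε, hε, W, hW, hpsd⟩ => by
      -- The radius `ε'` of prox-regularity is unrelated to `ε`; on `O` both localizations coincide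
      -- with `∂φ`, so the sign condition transfers between them.
      obtain ⟨O, hO, hOopen, hOmem⟩ := eventually_nhds_iff.1
        ((hsc.attentiveLocalization_germ hbot hε).and (hsc.attentiveLocalization_germ hbot hε'))
      refine isVariationallyConvexAt_of_regularCoderivative_posSemidef hbot hlsc hv hε' hr hpr
        (inter_mem hW (hOopen.mem_nhds hOmem)) fun u v huv w z hz => ?_
      refine hpsd u v ⟨(hO _ huv.2.2).1.2 huv.1.1, huv.2.1⟩ w z ?_
      rwa [regularCoderivative_congr (F' := limitingSubdifferential φ)
        (by filter_upwards [hOopen.mem_nhds huv.2.2] with p hp using (hO p hp).2)] at hz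
    tfae_finish
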